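/- Conventions. A lattice polytope in $\mathbb{R}^d$ is the convex hull of a non-empty finite set of points of $\mathbb{Z}^d$; its dimension is that of its affine hull. Let $Q\subset\mathbb{R}^d$ be a lattice polytope. A facet of $Q$ is a non-empty face of dimension $\dim(Q)-1$. An affine functional $u$ on $\operatorname{aff}(Q)$ is integral if it takes integer values on $\operatorname{aff}(Q)\cap\mathbb{Z}^d$, and primitive if moreover its values at some two points of $\operatorname{aff}(Q)\cap\mathbb{Z}^d$ differ by exactly $1$. A facet $F$ of $Q$ has lattice distance one from $x\in\operatorname{aff}(Q)$ if some primitive integral affine functional $u$ on $\operatorname{aff}(Q)$ is constant on $F$ with $\langle u,F\rangle-\langle u,x\rangle=1$. The polytope $Q$ is reflexive if there is a lattice point $x$ in the relative interior of $Q$ (not necessarily the origin) from which every facet of $Q$ has lattice distance one. It is Gorenstein if $mQ$ is reflexive for some integer $m\ge 1$. The codegree of $Q$ is the smallest integer $m\ge1$ such that $mQ$ has a lattice point in its relative interior. Sums of polytopes are Minkowski sums, and the empty sum is $\{0\}$. **Proposition 3.1.** Let $n\ge 0$, $l\ge 1$ and $r \geq 0$ be integers, and let $P_1,\dots,P_l\subset\mathbb{R}^n$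 be lattice polytopes such that $\dim(P_1+\cdots+P_l)=n$. Let $$P:=P_1*\cdots*P_l:=\operatorname{conv}\bigl((P_1\times\{e_1\})\cup\cdots\cup(P_l\times\{e_l\})\bigr)\subset\mathbb{R}^{n}\times\mathbb{R}^{l}=\mathbb{R}^{n+l}$$ be their Cayley polytope, where $e_1,\dots,e_l$ is the standard basis of $\mathbb{R}^l$. Then $P$ is a Gorenstein polytope of codegree $r$ if and only if there exists $(k_1,\dots,k_l)\in\mathbb{Z}_{\ge1}^l$ with $k_1+\cdots+k_l=r$ such that 1. $k_1P_1+\cdots+k_lP_l$ is reflexive, and 2. for every $i\in\{1,\dots,l\}$ with $k_i\ge2$, one has $\dim\bigl(\sum_{j\ne i}P_j\bigr)<n$. -/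

import Mathlib

open scoped Pointwise

noncomputable section

namespace LatticePolytope

variable {ι : Type*}

/-- The points of the lattice `ℤ^ι` inside `ℝ^ι`. -/
def IsLatticePoint (x : ι → ℝ) : Prop := ∀ i, ∃ z : ℤ, x i = z

/-- A lattice polytope: the non-empty convex hull of finitely many lattice points. -/
def IsLatticePolytope (P : Set (ι → ℝ)) : Prop :=
  ∃ S : Finset (ι → ℝ), S.Nonempty ∧ (∀ v ∈ S, IsLatticePoint v) ∧
    P = convexHull ℝ (S : Set (ι → ℝ))

/-- The dimension of a (non-empty) convex set, i.e. the dimension of its affine hull. -/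
def dim (P : Set (ι → ℝ)) : ℕ := Module.finrank ℝ (vectorSpan ℝ P)

/-- A facet: a non-empty (exposed) face whose dimension is one less than that of the polytope. -/
def IsFacet (P F : Set (ι → ℝ)) : Prop :=
  F.Nonempty ∧ IsExposed ℝ P F ∧ dim F + 1 = dim P

/-- `u` is integral on `aff P`: it takes integer values at the lattice points of `aff P`. (An
affine functional on `aff P` is given here by an extension to the whole space; only its values on
`aff P` matter.) -/
def IsIntegralOn (P : Set (ι → ℝ)) (u : (ι → ℝ) →ᵃ[ℝ] ℝ) : Prop :=
  ∀ y ∈ affineSpan ℝ P, IsLatticePoint y → ∃ z : ℤ, u y = z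

/-- `u` is a primitive integral affine functional on `aff P`: it is integral there, and its values
at some two lattice points of `aff P` differ by exactly one. -/
def IsPrimitiveOn (P : Set (ι → ℝ)) (u : (ι → ℝ) →ᵃ[ℝ] ℝ) : Prop :=
  IsIntegralOn P u ∧
    ∃ y ∈ affineSpan ℝ P, ∃ y' ∈ affineSpan ℝ P,
      IsLatticePoint y ∧ IsLatticePoint y' ∧ u y - u y' = 1

/-- The facet `F` of `P` has lattice distance `δ` from the point `x` of `aff P`, with respect to the
affine lattice of lattice points of `aff P`: some primitive integral affine functional `u` on
`aff P` is constant on `F`, and `⟨u, F⟩ - ⟨u, x⟩ = δ`. (Up to sign and an additive constant there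
is only one such `u`.) -/
def HasLatticeDistance (P F : Set (ι → ℝ)) (x : ι → ℝ) (δ : ℝ) : Prop :=
  ∃ u : (ι → ℝ) →ᵃ[ℝ] ℝ, IsPrimitiveOn P u ∧ ∀ y ∈ F, u y - u x = δ

/-- A lattice polytope is reflexive if some lattice point in its relative interior has lattice
distance one from every facet. This point need not be the origin, and if `P` is not
full-dimensional then everything refers to the affine lattice of lattice points of `aff P`. -/
def IsReflexive (P : Set (ι → ℝ)) : Prop :=
  IsLatticePolytope P ∧
    ∃ x ∈ intrinsicInterior ℝ P, IsLatticePoint x ∧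
      ∀ F, IsFacet P F → HasLatticeDistance P F x 1

/-- A lattice polytope is Gorenstein if some positive integral dilate of it is reflexive. -/
def IsGorenstein (P : Set (ι → ℝ)) : Prop :=
  IsLatticePolytope P ∧ ∃ m : ℕ, 1 ≤ m ∧ IsReflexive ((m : ℝ) • P)

/-- `P` is hollow if it has no lattice point in its relative interior. -/
def IsHollow (P : Set (ι → ℝ)) : Prop :=
  ∀ x ∈ intrinsicInterior ℝ P, ¬ IsLatticePoint x

/-- The codegree: the smallest positive integer `m` such that `m P` is not hollow. -/
def codegree (P : Set (ι → ℝ)) : ℕ :=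
  sInf {m : ℕ | 1 ≤ m ∧ ¬ IsHollow ((m : ℝ) • P)}

/-- The Cayley polytope `P₁ * ⋯ * Pₗ`: the convex hull of the union of the sets `Pᵢ × {eᵢ}` in
`ℝⁿ × ℝˡ = ℝⁿ⁺ˡ`, whose coordinates are indexed by `Fin n ⊕ Fin l`. -/
def cayley {n l : ℕ} (P : Fin l → Set (Fin n → ℝ)) : Set (Fin n ⊕ Fin l → ℝ) :=
  convexHull ℝ (⋃ i, (fun p : Fin n → ℝ => Sum.elim p (Pi.single i (1 : ℝ))) '' P i)

end LatticePolytope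

end

/-! Over a weight vector c with cᵢ ≥ 0 and ∑ cᵢ = m, the fibre of `m • cayley P` is ∑ cᵢ Pᵢ
(`mem_smul_cayley`). A lattice point in the relative interior of `m • cayley P` is therefore a pair
(q, k) with integers kᵢ ≥ 1 summing to m and q a lattice point in the relative interior of ∑ kᵢ Pᵢ
(`exists_eq_elim_of_mem_intrinsicInterior`, `elim_mem_intrinsicInterior`). It remains to compare
lattice distances to facets.

A facet of `m • cayley P` is exposed by a functional (v, c) ↦ a v + ∑ bᵢ cᵢ. Let Mᵢ be the maximum
of a on Pᵢ. If all Mᵢ + bᵢ agree, the facet is the dilated Cayley polytope of the faces Fᵢ of the Pᵢ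
where a = Mᵢ. Such facets match the facets ∑ kᵢ Fᵢ of ∑ kᵢ Pᵢ, because passing from the sum to the
Cayley polytope raises dimensions by l - 1 for the faces and for the whole alike. Distance one
transfers both ways (`isReflexive_sum_of_isReflexive_smul_cayley`,
`hasLatticeDistance_smul_cayley_face`). Otherwise the facet lies in some {zᵢ = 0}, which forces ∑_{j
≠ i} Pⱼ to have dimension n (`le_finrank_of_isFacet_of_forall_eq_zero`). Conversely, when that sum
has dimension n and n + l ≥ 2, {zᵢ = 0} cuts out a facet, and distance one means kᵢ = 1
(`eq_one_of_forall_hasLatticeDistance`). This is the second condition.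

The codegree is controlled by `le_of_isReflexive_smul`: integrality of facet functionals rules out
interior lattice points in dilates below the reflexive one. The case n = 0, l = 1 is exceptional:
the Cayley polytope is a point and all its dilates are reflexive. -/

noncomputable section

namespace LatticePolytope

/-! ### Relative interior via prolongation of segments -/

section IntrinsicInterior

variable {E : Type*} [NormedAddCommGroup E] [NormedSpace ℝ E]

theorem exists_extend_of_mem_intrinsicInterior {s : Set E} {x y : E}
    (hx : x ∈ intrinsicInterior ℝ s) (hy : y ∈ s) : ∃ ε : ℝ, 0 < ε ∧ x + ε • (x - y) ∈ s := by
  obtain ⟨x', hx', rfl⟩ := mem_intrinsicInterior.1 hx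
  have hy' := subset_affineSpan ℝ s hy
  let γ : ℝ → affineSpan ℝ s := fun t =>
    ⟨AffineMap.lineMap (x' : E) y (-t), AffineMap.lineMap_mem _ x'.2 hy'⟩
  have hγ : Continuous γ := by
    refine Continuous.subtype_mk ?_ _
    simp only [AffineMap.lineMap_apply_module']
    fun_prop
  have h0 : γ 0 = x' := by ext; simp [γ]
  have hmem : ∀ᶠ t in nhds (0 : ℝ), (γ t : E) ∈ s := by
    have : ((↑) ⁻¹' s : Set (affineSpan ℝ s)) ∈ nhds (γ 0) := by
      rw [h0]; exact mem_interior_iff_mem_nhds.1 hx'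
    exact hγ.continuousAt this
  obtain ⟨ε, hε, hpos⟩ := ((hmem.filter_mono nhdsWithin_le_nhds).and
    (self_mem_nhdsWithin : Set.Ioi (0 : ℝ) ∈ nhdsWithin 0 (Set.Ioi 0))).exists
  refine ⟨ε, hpos, ?_⟩
  convert hε using 1
  simp only [γ, AffineMap.lineMap_apply_module']
  module

/-- Prolong from a relative interior point z past x to a point w of s. Then x lies strictly between
w and z, and a homothety centred at w carries a neighbourhood of z inside s to a neighbourhood of x
inside s. -/
theorem mem_intrinsicInterior_of_forall_extend [FiniteDimensional ℝ E] {s : Set E}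
    (hs : Convex ℝ s) {x : E} (hx : x ∈ s)
    (h : ∀ y ∈ s, ∃ ε : ℝ, 0 < ε ∧ x + ε • (x - y) ∈ s) : x ∈ intrinsicInterior ℝ s := by
  obtain ⟨z, hz⟩ := Set.Nonempty.intrinsicInterior hs ⟨x, hx⟩
  obtain ⟨ε, hε, hw⟩ := h z (intrinsicInterior_subset hz)
  obtain ⟨z', hz', rfl⟩ := mem_intrinsicInterior.1 hz
  set w := x + ε • (x - (z' : E)) with hwdef
  have hw' := subset_affineSpan ℝ s hw
  -- The homothety centred at w with ratio (1 + ε) / ε sends x to z.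
  let φ : affineSpan ℝ s → affineSpan ℝ s := fun t =>
    ⟨AffineMap.lineMap w (t : E) ((1 + ε) / ε), AffineMap.lineMap_mem _ hw' t.2⟩
  have hφ : Continuous φ := by
    refine Continuous.subtype_mk ?_ _
    simp only [AffineMap.lineMap_apply_module']
    fun_prop
  let x' : affineSpan ℝ s := ⟨x, subset_affineSpan ℝ s hx⟩
  have h0 : φ x' = z' := by
    ext
    simp only [φ, x', AffineMap.lineMap_apply_module', hwdef]
    match_scalars <;> field_simp <;> ring
  refine mem_intrinsicInterior.2 ⟨x', mem_interior_iff_mem_nhds.2 ?_, rfl⟩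
  have hev : φ ⁻¹' ((↑) ⁻¹' s) ∈ nhds x' :=
    hφ.continuousAt (by rw [h0]; exact mem_interior_iff_mem_nhds.1 hz')
  filter_upwards [hev] with t ht
  have ht' : (φ t : E) ∈ s := ht
  have := hs hw ht' (a := 1 / (1 + ε)) (b := ε / (1 + ε)) (by positivity) (by positivity)
    (by field_simp)
  have heq : (t : E) = (1 / (1 + ε)) • w + (ε / (1 + ε)) • (φ t : E) := by
    simp only [φ, AffineMap.lineMap_apply_module']
    match_scalars <;> field_simp <;> ring
  rw [Set.mem_preimage, heq]
  exact this

end IntrinsicInterior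

/-! ### Linear spans and direction spaces -/

section Span

variable {E : Type*} [AddCommGroup E] [Module ℝ E]

theorem sub_smul_mem_vectorSpan {P : Set E} {h : E →ₗ[ℝ] ℝ} {m : ℝ} (hm : m ≠ 0)
    (hP : ∀ p ∈ P, h p = m) {p z : E} (hp : p ∈ P) (hz : z ∈ Submodule.span ℝ P) :
    z - (h z / m) • p ∈ vectorSpan ℝ P := by
  induction hz using Submodule.span_induction with
  | mem x hx =>
    rw [hP x hx, div_self hm, one_smul]
    exact vsub_mem_vectorSpan ℝ hx hp
  | zero => simp
  | add x y _ _ hx hy =>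
    convert add_mem hx hy using 1
    rw [map_add]; module
  | smul a x _ hx =>
    convert Submodule.smul_mem _ a hx using 1
    rw [map_smul, smul_eq_mul]; module

theorem mem_affineSpan_of_mem_span {P : Set E} {h : E →ₗ[ℝ] ℝ} {m : ℝ} (hm : m ≠ 0)
    (hP : ∀ p ∈ P, h p = m) (hne : P.Nonempty) {z : E} (hz : z ∈ Submodule.span ℝ P)
    (hhz : h z = m) : z ∈ affineSpan ℝ P := by
  obtain ⟨p, hp⟩ := hne
  have := sub_smul_mem_vectorSpan hm hP hp hz
  rw [hhz, div_self hm, one_smul, ← direction_affineSpan] at this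
  have h2 := AffineSubspace.vadd_mem_of_mem_direction this (subset_affineSpan ℝ P hp)
  simpa using h2

/-- A level {h = m} with m ≠ 0 misses the origin, so any point of P spans a complement of the
direction space. Dimension counts for polytopes thereby become counts of linear ranks. -/
theorem finrank_span_eq_finrank_vectorSpan_add_one [FiniteDimensional ℝ E] {P : Set E}
    {h : E →ₗ[ℝ] ℝ} {m : ℝ} (hm : m ≠ 0) (hP : ∀ p ∈ P, h p = m) (hne : P.Nonempty) :
    Module.finrank ℝ (Submodule.span ℝ P) = Module.finrank ℝ (vectorSpan ℝ P) + 1 := by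
  obtain ⟨p, hp⟩ := hne
  have hker : vectorSpan ℝ P ≤ LinearMap.ker h := by
    rw [vectorSpan_def, Submodule.span_le]
    rintro _ ⟨a, ha, b, hb, rfl⟩
    simp [hP a ha, hP b hb]
  have hp0 : p ≠ 0 := by
    rintro rfl
    exact hm (by rw [← hP 0 hp, map_zero])
  have hsup : Submodule.span ℝ P = vectorSpan ℝ P ⊔ Submodule.span ℝ {p} := by
    apply le_antisymm
    · intro z hz
      have := sub_smul_mem_vectorSpan hm hP hp hz
      rw [Submodule.mem_sup]
      exact ⟨_, this, _, Submodule.smul_mem _ (h z / m) (Submodule.mem_span_singleton_self p),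
        by simp⟩
    · refine sup_le ?_ (Submodule.span_mono (by simpa using hp))
      rw [vectorSpan_def, Submodule.span_le]
      rintro _ ⟨a, ha, b, hb, rfl⟩
      exact sub_mem (Submodule.subset_span ha) (Submodule.subset_span hb)
  have hinf : vectorSpan ℝ P ⊓ Submodule.span ℝ {p} = ⊥ := by
    rw [eq_bot_iff]
    rintro z ⟨hz1, hz2⟩
    obtain ⟨c, rfl⟩ := Submodule.mem_span_singleton.1 hz2
    have := hker hz1
    rw [LinearMap.mem_ker, map_smul, hP p hp, smul_eq_mul] at this
    have hc : c = 0 := by simpa [hm] using this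
    simp [hc]
  have := Submodule.finrank_sup_add_finrank_inf_eq (vectorSpan ℝ P) (Submodule.span ℝ {p})
  rw [hinf, finrank_bot, ← hsup, finrank_span_singleton hp0] at this
  simpa using this

theorem vectorSpan_smul_set {c : ℝ} (hc : c ≠ 0) (P : Set E) :
    vectorSpan ℝ (c • P) = vectorSpan ℝ P := by
  have key : ∀ (c : ℝ) (P : Set E), vectorSpan ℝ (c • P) ≤ vectorSpan ℝ P := by
    intro c P
    rw [vectorSpan_def, Submodule.span_le]
    rintro _ ⟨_, ⟨a, ha, rfl⟩, _, ⟨b, hb, rfl⟩, rfl⟩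
    simp only [vsub_eq_sub, ← smul_sub]
    exact Submodule.smul_mem _ _ (vsub_mem_vectorSpan ℝ ha hb)
  refine le_antisymm (key c P) ?_
  simpa [inv_smul_smul₀ hc] using key c⁻¹ (c • P)

theorem vectorSpan_add_set {A B : Set E} (hA : A.Nonempty) (hB : B.Nonempty) :
    vectorSpan ℝ (A + B) = vectorSpan ℝ A ⊔ vectorSpan ℝ B := by
  obtain ⟨a0, ha0⟩ := hA
  obtain ⟨b0, hb0⟩ := hB
  apply le_antisymm
  · rw [vectorSpan_def, Submodule.span_le]
    rintro _ ⟨_, ⟨a, ha, b, hb, rfl⟩, _, ⟨a', ha', b', hb', rfl⟩, rfl⟩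
    refine Submodule.mem_sup.2 ⟨a - a', vsub_mem_vectorSpan ℝ ha ha', b - b',
      vsub_mem_vectorSpan ℝ hb hb', ?_⟩
    simp only [vsub_eq_sub]; abel
  · refine sup_le ?_ ?_
    · rw [vectorSpan_def, Submodule.span_le]
      rintro _ ⟨a, ha, a', ha', rfl⟩
      have := vsub_mem_vectorSpan ℝ (Set.add_mem_add ha hb0) (Set.add_mem_add ha' hb0)
      simpa using this
    · rw [vectorSpan_def, Submodule.span_le]
      rintro _ ⟨b, hb, b', hb', rfl⟩
      have := vsub_mem_vectorSpan ℝ (Set.add_mem_add ha0 hb) (Set.add_mem_add ha0 hb')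
      simpa using this

theorem vectorSpan_sum_set {κ : Type*} (J : Finset κ) {A : κ → Set E}
    (hA : ∀ j, (A j).Nonempty) :
    vectorSpan ℝ (∑ j ∈ J, A j) = ⨆ j ∈ J, vectorSpan ℝ (A j) := by
  classical
  induction J using Finset.induction_on with
  | empty => simp [← Set.singleton_zero, vectorSpan_singleton]
  | insert i J hi ih =>
    have hne : (∑ j ∈ J, A j).Nonempty := by
      choose a ha using hA
      exact ⟨∑ j ∈ J, a j, Set.finsetSum_mem_finsetSum _ _ _ fun j _ => ha j⟩
    rw [Finset.sum_insert hi, vectorSpan_add_set (hA i) hne, ih, Finset.iSup_insert]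

end Span

/-! ### Lattice points and lattice polytopes -/

variable {ι : Type*}

/-- An affine functional agrees on a level set of a linear one with a linear functional. -/
theorem exists_linear_eq_on_level {E : Type*} [AddCommGroup E] [Module ℝ E] (u : E →ᵃ[ℝ] ℝ)
    (h : E →ₗ[ℝ] ℝ) {m : ℝ} (hm : m ≠ 0) :
    ∃ g : E →ₗ[ℝ] ℝ, ∀ z, h z = m → g z = u z := by
  refine ⟨u.linear + (u 0 / m) • h, fun z hz => ?_⟩
  have := u.map_vadd 0 z
  simp only [vadd_eq_add, add_zero] at this
  rw [this, LinearMap.add_apply, LinearMap.smul_apply, hz, smul_eq_mul, div_mul_cancel₀ _ hm]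

theorem IsLatticePoint.add {x y : ι → ℝ} (hx : IsLatticePoint x) (hy : IsLatticePoint y) :
    IsLatticePoint (x + y) := fun i => by
  obtain ⟨a, ha⟩ := hx i
  obtain ⟨b, hb⟩ := hy i
  exact ⟨a + b, by simp [ha, hb]⟩

theorem IsLatticePoint.sub {x y : ι → ℝ} (hx : IsLatticePoint x) (hy : IsLatticePoint y) :
    IsLatticePoint (x - y) := fun i => by
  obtain ⟨a, ha⟩ := hx i
  obtain ⟨b, hb⟩ := hy i
  exact ⟨a - b, by simp [ha, hb]⟩

theorem IsLatticePoint.natCast_smul {x : ι → ℝ} (hx : IsLatticePoint x) (m : ℕ) :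
    IsLatticePoint ((m : ℝ) • x) := fun i => by
  obtain ⟨a, ha⟩ := hx i
  exact ⟨m * a, by simp [ha]⟩

theorem isLatticePoint_zero : IsLatticePoint (0 : ι → ℝ) := fun _ => ⟨0, by simp⟩

theorem isLatticePoint_single [DecidableEq ι] (i : ι) :
    IsLatticePoint (Pi.single i (1 : ℝ)) := fun j => by
  by_cases h : j = i
  · subst h; exact ⟨1, by simp⟩
  · exact ⟨0, by simp [h]⟩

theorem IsLatticePolytope.convex {P : Set (ι → ℝ)} (hP : IsLatticePolytope P) : Convex ℝ P := by
  obtain ⟨S, _, _, rfl⟩ := hP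
  exact convex_convexHull ℝ _

theorem IsLatticePolytope.nonempty {P : Set (ι → ℝ)} (hP : IsLatticePolytope P) :
    P.Nonempty := by
  obtain ⟨S, hS, _, rfl⟩ := hP
  exact (Finset.coe_nonempty.2 hS).convexHull

theorem IsLatticePolytope.natCast_smul {P : Set (ι → ℝ)} (hP : IsLatticePolytope P) (m : ℕ) :
    IsLatticePolytope ((m : ℝ) • P) := by
  classical
  obtain ⟨S, hS, hl, rfl⟩ := hP
  refine ⟨S.image fun s => (m : ℝ) • s, hS.image _, ?_, ?_⟩
  · intro v hv
    obtain ⟨s, hs, rfl⟩ := Finset.mem_image.1 hv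
    exact (hl s hs).natCast_smul m
  · rw [← convexHull_smul, Finset.coe_image]; rfl

theorem IsLatticePolytope.add {P Q : Set (ι → ℝ)} (hP : IsLatticePolytope P)
    (hQ : IsLatticePolytope Q) : IsLatticePolytope (P + Q) := by
  classical
  obtain ⟨S, hS, hl, rfl⟩ := hP
  obtain ⟨T, hT, hl', rfl⟩ := hQ
  refine ⟨S + T, hS.add hT, ?_, by rw [Finset.coe_add, convexHull_add]⟩
  intro v hv
  obtain ⟨s, hs, t, ht, rfl⟩ := Finset.mem_add.1 hv
  exact (hl s hs).add (hl' t ht)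

theorem IsLatticePolytope.sum {κ : Type*} (J : Finset κ) {P : κ → Set (ι → ℝ)}
    (hP : ∀ j ∈ J, IsLatticePolytope (P j)) : IsLatticePolytope (∑ j ∈ J, P j) := by
  refine Finset.sum_induction P IsLatticePolytope (fun _ _ => IsLatticePolytope.add) ?_ hP
  exact ⟨{0}, by simp, by simpa using isLatticePoint_zero, by simp [Set.singleton_zero]⟩

theorem exists_mem_ge_of_mem_convexHull {E : Type*} [AddCommGroup E] [Module ℝ E] {S : Set E}
    {x : E} (hx : x ∈ convexHull ℝ S) (f : E →ₗ[ℝ] ℝ) : ∃ s ∈ S, f x ≤ f s := by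
  by_contra! hcon
  have : convexHull ℝ S ⊆ {z | f z < f x} :=
    convexHull_min hcon (convex_halfSpace_lt f.isLinear _)
  exact lt_irrefl (f x) (this hx)

theorem IsLatticePolytope.exists_isMaxOn {P : Set (ι → ℝ)} (hP : IsLatticePolytope P)
    (f : (ι → ℝ) →ₗ[ℝ] ℝ) : ∃ p ∈ P, IsLatticePoint p ∧ ∀ q ∈ P, f q ≤ f p := by
  obtain ⟨S, hS, hl, rfl⟩ := hP
  obtain ⟨p, hp, hmax⟩ := S.exists_max_image f hS
  refine ⟨p, subset_convexHull ℝ _ hp, hl p hp, fun q hq => ?_⟩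
  obtain ⟨s, hs, hle⟩ := exists_mem_ge_of_mem_convexHull hq f
  exact hle.trans (hmax s hs)

theorem IsLatticePolytope.exists_isLatticePoint_mem_face {P F : Set (ι → ℝ)}
    (hP : IsLatticePolytope P) (hF : IsExposed ℝ P F) (hne : F.Nonempty) :
    ∃ p ∈ F, IsLatticePoint p := by
  obtain ⟨L, rfl⟩ := hF hne
  obtain ⟨p, hp, hl, hmax⟩ := hP.exists_isMaxOn (L : (ι → ℝ) →ₗ[ℝ] ℝ)
  exact ⟨p, ⟨hp, hmax⟩, hl⟩

/-- For distance one, primitivity is automatic. -/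
theorem hasLatticeDistance_one {P F : Set (ι → ℝ)} {x : ι → ℝ} (hP : IsLatticePolytope P)
    (hF : IsFacet P F) (hx : x ∈ affineSpan ℝ P) (hxl : IsLatticePoint x)
    (u : (ι → ℝ) →ᵃ[ℝ] ℝ) (hu : IsIntegralOn P u) (h : ∀ y ∈ F, u y - u x = 1) :
    HasLatticeDistance P F x 1 := by
  obtain ⟨p, hp, hpl⟩ := hP.exists_isLatticePoint_mem_face hF.2.1 hF.1
  exact ⟨u, ⟨hu, p, subset_affineSpan ℝ P (hF.2.1.subset hp), x, hx, hpl, hxl, h p hp⟩, h⟩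

/-! ### Vertices of a slice of the dual cone -/

section DualCone

variable {E : Type*} [NormedAddCommGroup E] [NormedSpace ℝ E] [FiniteDimensional ℝ E]

/-- The functionals that are nonnegative on `S` and normalized at `x`. -/
def dualSlice (S : Finset E) (x : E) : Set (E →L[ℝ] ℝ) := {f | (∀ s ∈ S, 0 ≤ f s) ∧ f x = 1}

/-- Since S spans, evaluation on S is a closed embedding of the dual space into ℝ^S, and the slice
is a closed set landing in a box. -/
theorem isCompact_dualSlice {S : Finset E} {x : E} (hS : Submodule.span ℝ (S : Set E) = ⊤)
    {C : E → ℝ} (hC : ∀ f ∈ dualSlice S x, ∀ s ∈ S, f s ≤ C s) : IsCompact (dualSlice S x) := by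
  let e : (E →L[ℝ] ℝ) →ₗ[ℝ] (S → ℝ) :=
    { toFun := fun f s => f s
      map_add' := fun f g => rfl
      map_smul' := fun c f => rfl }
  have he : LinearMap.ker e = ⊥ := by
    rw [LinearMap.ker_eq_bot']
    intro f hf
    have h0 : ∀ s ∈ S, f s = 0 := fun s hs => congrFun hf ⟨s, hs⟩
    have : (f : E →ₗ[ℝ] ℝ) = 0 := LinearMap.ext_on hS fun s hs => h0 s hs
    ext z
    exact LinearMap.congr_fun this z
  have hemb := LinearMap.isClosedEmbedding_of_injective he
  have hcpt : IsCompact (e ⁻¹' Set.Icc (0 : S → ℝ) fun s => C s) :=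
    hemb.isCompact_preimage isCompact_Icc
  refine hcpt.of_isClosed_subset ?_ ?_
  · have : dualSlice S x = (⋂ s ∈ S, {f : E →L[ℝ] ℝ | 0 ≤ f s}) ∩ {f | f x = 1} := by
      ext f; simp [dualSlice]
    rw [this]
    refine IsClosed.inter (isClosed_biInter fun s _ => ?_) ?_
    · exact isClosed_le continuous_const (ContinuousLinearMap.apply ℝ ℝ s).continuous
    · exact isClosed_eq (ContinuousLinearMap.apply ℝ ℝ x).continuous continuous_const
  · intro f hf
    exact ⟨fun s => hf.1 s s.2, fun s => hC f hf s s.2⟩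

/-- Otherwise some g ≠ 0 vanishes at x and at every s where f vanishes. For small t > 0 both f + t g
and f - t g stay in the slice, contradicting extremality. -/
theorem span_eq_top_of_mem_extremePoints_dualSlice {S : Finset E} {x : E} {f : E →L[ℝ] ℝ}
    (hf : f ∈ Set.extremePoints ℝ (dualSlice S x)) :
    Submodule.span ℝ (insert x {s | s ∈ S ∧ f s = 0}) = ⊤ := by
  by_contra hne
  obtain ⟨g, hg0, hg⟩ := Submodule.exists_le_ker_of_lt_top _ (lt_top_iff_ne_top.2 hne)
  have hgx : g x = 0 := hg (Submodule.subset_span (Set.mem_insert _ _))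
  have hgs : ∀ s ∈ S, f s = 0 → g s = 0 := fun s hs h =>
    hg (Submodule.subset_span (Set.mem_insert_of_mem _ ⟨hs, h⟩))
  obtain ⟨hfS, hfx⟩ := hf.1
  have hev : ∀ᶠ t in nhds (0 : ℝ), ∀ s ∈ S, 0 ≤ f s + t * g s := by
    rw [Filter.eventually_all_finset]
    intro s hs
    rcases (hfS s hs).eq_or_lt with h | h
    · exact Filter.Eventually.of_forall fun t => by rw [← h, hgs s hs h.symm]; simp
    · have hc : Continuous fun t : ℝ => f s + t * g s := by fun_prop
      have : ∀ᶠ t in nhds (0 : ℝ), 0 < f s + t * g s :=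
        hc.continuousAt.eventually (lt_mem_nhds (by simpa using h))
      exact this.mono fun t ht => ht.le
  have hev' : ∀ᶠ t in nhds (0 : ℝ), ∀ s ∈ S, 0 ≤ f s + -t * g s := by
    have : Filter.Tendsto (fun t : ℝ => -t) (nhds 0) (nhds 0) := by
      simpa using (continuous_neg (G := ℝ)).tendsto 0
    exact this.eventually hev
  obtain ⟨t, ⟨h1, h2⟩, ht⟩ := (((hev.and hev').filter_mono nhdsWithin_le_nhds).and
    (self_mem_nhdsWithin : Set.Ioi (0 : ℝ) ∈ nhdsWithin 0 (Set.Ioi 0))).exists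
  let G : E →L[ℝ] ℝ := LinearMap.toContinuousLinearMap g
  have hG : ∀ z, G z = g z := fun z => rfl
  have m1 : f + t • G ∈ dualSlice S x := ⟨fun s hs => by simpa [hG] using h1 s hs, by
    simp [hG, hgx, hfx]⟩
  have m2 : f + (-t) • G ∈ dualSlice S x := ⟨fun s hs => by simpa [hG] using h2 s hs, by
    simp [hG, hgx, hfx]⟩
  have := hf.2 m1 m2 ⟨1 / 2, 1 / 2, by norm_num, by norm_num, by norm_num, by module⟩
  have hz : t • G = 0 := by simpa using this
  rcases smul_eq_zero.1 hz with h | h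
  · exact (ne_of_gt ht) h
  · exact hg0 (LinearMap.ext fun z => by rw [← hG, h]; rfl)

/-- The minimizers of evaluation at y form a non-empty compact exposed face of the slice. It has an
extreme point, which is also extreme in the slice. -/
theorem exists_minimizer_dualSlice {S : Finset E} {x : E}
    (hS : Submodule.span ℝ (S : Set E) = ⊤)
    {C : E → ℝ} (hC : ∀ f ∈ dualSlice S x, ∀ s ∈ S, f s ≤ C s)
    (hne : (dualSlice S x).Nonempty) (y : E) :
    ∃ f ∈ dualSlice S x, Submodule.span ℝ (insert x {s | s ∈ S ∧ f s = 0}) = ⊤ ∧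
      ∀ g ∈ dualSlice S x, f y ≤ g y := by
  have hcpt := isCompact_dualSlice hS hC
  let ev : StrongDual ℝ (E →L[ℝ] ℝ) := ContinuousLinearMap.apply ℝ ℝ y
  let T : Set (E →L[ℝ] ℝ) :=
    {f | f ∈ dualSlice S x ∧ ∀ g ∈ dualSlice S x, (-ev) g ≤ (-ev) f}
  have hT : IsExposed ℝ (dualSlice S x) T := fun _ => ⟨-ev, rfl⟩
  have hTne : T.Nonempty := by
    obtain ⟨f, hf, hmax⟩ := hcpt.exists_isMaxOn hne (-ev).continuous.continuousOn
    exact ⟨f, hf, hmax⟩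
  obtain ⟨f, hf⟩ := (hT.isCompact hcpt).extremePoints_nonempty hTne
  refine ⟨f, hf.1.1, span_eq_top_of_mem_extremePoints_dualSlice
    (hT.isExtreme.extremePoints_subset_extremePoints hf), fun g hg => ?_⟩
  have : -(g y) ≤ -(f y) := hf.1.2 g hg
  linarith

end DualCone

/-! ### The codegree of a polytope with a reflexive dilate -/

theorem dim_add_one {P : Set (ι → ℝ)} [Fintype ι] {h : (ι → ℝ) →ₗ[ℝ] ℝ} {m : ℝ} (hm : m ≠ 0)
    (hP : ∀ p ∈ P, h p = m) (hne : P.Nonempty) :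
    dim P + 1 = Module.finrank ℝ (Submodule.span ℝ P) :=
  (finrank_span_eq_finrank_vectorSpan_add_one hm hP hne).symm

/-- If `m P` is reflexive and `P` is not a point, then no smaller dilate has a lattice point in
its relative interior. -/
theorem le_of_isReflexive_smul [Fintype ι] {P : Set (ι → ℝ)} (hP : IsLatticePolytope P)
    {h : (ι → ℝ) →ₗ[ℝ] ℝ} (hh : ∀ p ∈ P, h p = 1) (hspan : Submodule.span ℝ P = ⊤)
    (hcard : 2 ≤ Fintype.card ι) {m r : ℕ} (hm : 1 ≤ m) (hr : 1 ≤ r)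
    (href : IsReflexive ((m : ℝ) • P)) {y : ι → ℝ}
    (hy : y ∈ intrinsicInterior ℝ ((r : ℝ) • P)) (hyl : IsLatticePoint y) : m ≤ r := by
  classical
  by_contra! hlt
  obtain ⟨hmP, x, hx, hxl, hdist⟩ := href
  obtain ⟨S, hSne, hSl, rfl⟩ := hP
  set P := convexHull ℝ (S : Set (ι → ℝ)) with hPdef
  have hm0 : (0 : ℝ) < m := by exact_mod_cast hm
  have hr0 : (0 : ℝ) < r := by exact_mod_cast hr
  have hSP : ∀ s ∈ S, s ∈ P := fun s hs => subset_convexHull ℝ _ hs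
  have hmh : ∀ z ∈ (m : ℝ) • P, h z = m := by
    rintro _ ⟨p, hp, rfl⟩
    simp [hh p hp]
  have hrh : ∀ z ∈ (r : ℝ) • P, h z = r := by
    rintro _ ⟨p, hp, rfl⟩
    simp [hh p hp]
  have hxP := intrinsicInterior_subset hx
  have hyP := intrinsicInterior_subset hy
  have hSspan : Submodule.span ℝ (S : Set (ι → ℝ)) = ⊤ := by
    rw [eq_top_iff, ← hspan, Submodule.span_le]
    exact convexHull_min Submodule.subset_span (Submodule.convex _)
  -- functionals of the dual slice are nonnegative on all dilates
  have hnonneg : ∀ f ∈ dualSlice S x, ∀ c : ℝ, 0 ≤ c → ∀ z ∈ c • P, 0 ≤ f z := by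
    rintro f hf c hc _ ⟨p, hp, rfl⟩
    have : P ⊆ {z | 0 ≤ f z} :=
      convexHull_min (fun s hs => hf.1 s hs) (convex_halfSpace_ge f.isLinear 0)
    have := this hp
    simp only [map_smul, smul_eq_mul]
    exact mul_nonneg hc this
  -- Prolonging from m s past x by ε stays in m P, and f ≥ 0 there reads 1 + ε - ε m f(s) ≥ 0.
  have hbound : ∀ s ∈ S, ∃ C : ℝ, ∀ f ∈ dualSlice S x, f s ≤ C := by
    intro s hs
    obtain ⟨ε, hε, hmem⟩ := exists_extend_of_mem_intrinsicInterior hx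
      (Set.smul_mem_smul_set (a := (m : ℝ)) (hSP s hs))
    refine ⟨(1 + ε) / (ε * m), fun f hf => ?_⟩
    have := hnonneg f hf m hm0.le _ hmem
    rw [le_div_iff₀ (by positivity)]
    simp only [map_add, map_smul, map_sub, hf.2, smul_eq_mul] at this
    linarith
  choose! C hC using hbound
  let H : (ι → ℝ) →L[ℝ] ℝ := LinearMap.toContinuousLinearMap ((1 / (m : ℝ)) • h)
  have hHapp : ∀ z, H z = h z / m := fun z => by
    change (1 / (m : ℝ)) * h z = _
    ring
  have hHmem : H ∈ dualSlice S x := by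
    refine ⟨fun s hs => ?_, ?_⟩
    · rw [hHapp, hh s (hSP s hs)]; positivity
    · rw [hHapp, hmh x hxP, div_self hm0.ne']
  -- The vertex f defines a facet of m P. Integrality will give f y ≥ 1, whereas minimality against
  -- `H` gives f y ≤ r / m < 1.
  obtain ⟨f, hf, hfspan, hfmin⟩ := exists_minimizer_dualSlice hSspan
    (fun f hf s hs => hC s hs f hf) ⟨H, hHmem⟩ y
  set F : Set (ι → ℝ) := {z | z ∈ (m : ℝ) • P ∧ f z = 0} with hFdef
  have hmemF : ∀ s ∈ S, f s = 0 → (m : ℝ) • s ∈ F := fun s hs hs0 =>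
    ⟨Set.smul_mem_smul_set (hSP s hs), by simp [hs0]⟩
  have hFsup : Submodule.span ℝ F ⊔ Submodule.span ℝ {x} = ⊤ := by
    rw [eq_top_iff, ← hfspan, Submodule.span_le]
    rintro z (rfl | ⟨hz, hz0⟩)
    · exact Submodule.mem_sup_right (Submodule.mem_span_singleton_self _)
    · refine Submodule.mem_sup_left ?_
      have := Submodule.smul_mem _ (m : ℝ)⁻¹ (Submodule.subset_span (hmemF z hz hz0) :
        _ ∈ Submodule.span ℝ F)
      rwa [inv_smul_smul₀ hm0.ne'] at this
  have hfinE : Module.finrank ℝ (ι → ℝ) = Fintype.card ι := Module.finrank_fintype_fun_eq_card ℝ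
  have hx1 : Module.finrank ℝ (Submodule.span ℝ ({x} : Set (ι → ℝ))) ≤ 1 :=
    (finrank_span_le_card _).trans (by simp)
  have hge : Fintype.card ι ≤ Module.finrank ℝ (Submodule.span ℝ F) + 1 := by
    have := Submodule.finrank_add_le_finrank_add_finrank (Submodule.span ℝ F)
      (Submodule.span ℝ {x})
    rw [hFsup, finrank_top, hfinE] at this
    omega
  -- If f vanished nowhere on S, then x alone would span the space, contrary to `hcard`.
  obtain ⟨s0, hs0S, hs0⟩ : ∃ s ∈ S, f s = 0 := by
    by_contra! hcon
    have hempty : {s | s ∈ S ∧ f s = 0} = (∅ : Set (ι → ℝ)) := by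
      ext s; simpa using hcon s
    rw [hempty] at hfspan
    have : Module.finrank ℝ (Submodule.span ℝ (insert x (∅ : Set (ι → ℝ)))) =
        Fintype.card ι := by rw [hfspan, finrank_top, hfinE]
    rw [insert_empty_eq] at this
    omega
  have hFne : F.Nonempty := ⟨_, hmemF s0 hs0S hs0⟩
  have hFker : Submodule.span ℝ F ≤ LinearMap.ker (f : (ι → ℝ) →ₗ[ℝ] ℝ) := by
    rw [Submodule.span_le]
    exact fun z hz => hz.2
  have hltE : Module.finrank ℝ (Submodule.span ℝ F) < Fintype.card ι := by
    rw [← hfinE]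
    refine Submodule.finrank_lt fun htop => ?_
    have : x ∈ Submodule.span ℝ F := htop ▸ Submodule.mem_top
    have h0 : f x = 0 := hFker this
    rw [hf.2] at h0
    exact one_ne_zero h0
  have hmspan : Submodule.span ℝ ((m : ℝ) • P) = ⊤ := by
    rw [Submodule.span_smul_eq_of_isUnit _ _ (IsUnit.mk0 _ hm0.ne'), hspan]
  have hfacet : IsFacet ((m : ℝ) • P) F := by
    refine ⟨hFne, fun _ => ⟨-f, ?_⟩, ?_⟩
    · ext z
      refine and_congr_right fun hz => ⟨fun h0 w hw => ?_, fun hmax => ?_⟩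
      · have := hnonneg f hf m hm0.le w hw
        simp only [neg_apply, h0]
        linarith
      · have h1 := hnonneg f hf m hm0.le z hz
        have h2 := hmax _ (hmemF s0 hs0S hs0).1
        simp only [neg_apply, (hmemF s0 hs0S hs0).2] at h2
        linarith
    · have e1 := dim_add_one hm0.ne' (fun z hz => hmh z hz.1) hFne
      have e2 := dim_add_one hm0.ne' hmh ⟨x, hxP⟩
      rw [hmspan, finrank_top, hfinE] at e2
      omega
  obtain ⟨u, ⟨huint, -⟩, hu⟩ := hdist F hfacet
  obtain ⟨g, hg⟩ := exists_linear_eq_on_level u h hm0.ne'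
  -- Both sides are given on the level {h = m} by linear functionals vanishing on F and equal to 1
  -- at x, and F together with x spans. Hence f is integral at lattice points of this level.
  have hfg : ∀ z, h z = m → f z = (1 + u x) - u z := by
    have : (f : (ι → ℝ) →ₗ[ℝ] ℝ) = ((1 + u x) / m) • h - g := by
      refine LinearMap.ext_on (hFsup.symm ▸ (Submodule.span_union F {x})) ?_
      rintro z (hz | rfl)
      · have h1 := hmh z hz.1
        have h2 := hu z hz
        simp only [ContinuousLinearMap.coe_coe, hz.2, LinearMap.sub_apply, LinearMap.smul_apply,
          h1, hg z h1, smul_eq_mul]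
        field_simp
        linarith
      · have h1 := hmh z hxP
        simp only [ContinuousLinearMap.coe_coe, hf.2, LinearMap.sub_apply, LinearMap.smul_apply,
          h1, hg z h1, smul_eq_mul]
        field_simp
        ring
    intro z hz
    have h3 := LinearMap.congr_fun this z
    simp only [ContinuousLinearMap.coe_coe, LinearMap.sub_apply, LinearMap.smul_apply,
      hz, hg z hz, smul_eq_mul] at h3
    rw [h3]
    field_simp
  have haff : ∀ z, h z = m → z ∈ affineSpan ℝ ((m : ℝ) • P) := fun z hz =>
    mem_affineSpan_of_mem_span hm0.ne' hmh ⟨x, hxP⟩ (hmspan ▸ Submodule.mem_top) hz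
  -- Adding copies of the lattice point s0 raises y from height r to height m without changing f,
  -- since f s0 = 0.
  set w := y + ((m - r : ℕ) : ℝ) • s0 with hw
  have hhw : h w = m := by
    rw [hw, map_add, map_smul, hrh y hyP, hh s0 (hSP s0 hs0S), Nat.cast_sub hlt.le]
    simp
  have hfw : f w = f y := by simp [hw, hs0]
  obtain ⟨a, ha⟩ := huint w (haff w hhw) (hyl.add ((hSl s0 hs0S).natCast_smul _))
  obtain ⟨b, hb⟩ := huint x (haff x (hmh x hxP)) hxl
  have hfy : f y = ((1 + b - a : ℤ) : ℝ) := by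
    rw [← hfw, hfg w hhw, ha, hb]; push_cast; ring
  -- The point p = x / m of P has f p = 1 / m > 0. As f ≥ 0 on r P, prolonging from r p past y
  -- forces f y > 0.
  have hpos : 0 < f y := by
    obtain ⟨p, hp, hpx⟩ := hxP
    obtain ⟨ε, hε, hmem⟩ := exists_extend_of_mem_intrinsicInterior hy
      (Set.smul_mem_smul_set (a := (r : ℝ)) hp)
    have h1 := hnonneg f hf r hr0.le _ hmem
    have h2 : m * f p = 1 := by rw [← hf.2, ← hpx]; simp
    have h3 : 0 < f p := by
      by_contra! hneg
      nlinarith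
    simp only [map_add, map_smul, map_sub, smul_eq_mul] at h1
    have h4 : 0 < ε * (r * f p) := by positivity
    by_contra! hneg
    nlinarith
  have hge1 : (1 : ℝ) ≤ f y := by
    rw [hfy] at hpos ⊢
    have : 0 < 1 + b - a := by exact_mod_cast hpos
    exact_mod_cast (by omega : 1 ≤ 1 + b - a)
  have hle := hfmin H hHmem
  rw [hHapp, hrh y hyP] at hle
  have : (r : ℝ) / m < 1 := by
    rw [div_lt_one hm0]; exact_mod_cast hlt
  linarith

theorem codegree_eq_of_isReflexive_smul [Fintype ι] {P : Set (ι → ℝ)} (hP : IsLatticePolytope P)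
    {h : (ι → ℝ) →ₗ[ℝ] ℝ} (hh : ∀ p ∈ P, h p = 1) (hspan : Submodule.span ℝ P = ⊤) {m : ℕ}
    (hm : 1 ≤ m) (hcard : 2 ≤ Fintype.card ι ∨ m = 1) (href : IsReflexive ((m : ℝ) • P)) :
    codegree P = m := by
  have hmem : m ∈ {m : ℕ | 1 ≤ m ∧ ¬ IsHollow ((m : ℝ) • P)} := by
    refine ⟨hm, fun hhol => ?_⟩
    obtain ⟨-, x, hx, hxl, -⟩ := href
    exact hhol x hx hxl
  refine le_antisymm (Nat.sInf_le hmem) (le_csInf ⟨m, hmem⟩ ?_)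
  rintro r ⟨hr, hhol⟩
  rcases hcard with hcard | rfl
  · simp only [IsHollow, not_forall, not_not] at hhol
    obtain ⟨y, hy, hyl⟩ := hhol
    exact le_of_isReflexive_smul hP hh hspan hcard hm hr href hy hyl
  · exact hr

/-! ### Weighted Minkowski sums and exposed faces -/

theorem exists_smul_add_smul_eq {E : Type*} [AddCommGroup E] [Module ℝ E] {C : Set E}
    (hC : Convex ℝ C) {p q : E} (hp : p ∈ C) (hq : q ∈ C) {a b : ℝ} (ha : 0 ≤ a) (hb : 0 ≤ b) :
    ∃ r ∈ C, a • p + b • q = (a + b) • r := by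
  have h := hC.add_smul ha hb
  have : a • p + b • q ∈ (a + b) • C := by
    rw [h]
    exact Set.add_mem_add (Set.smul_mem_smul_set hp) (Set.smul_mem_smul_set hq)
  obtain ⟨r, hr, h⟩ := this
  exact ⟨r, hr, h.symm⟩

theorem mem_sum_smul {κ E : Type*} [Fintype κ] [AddCommGroup E] [Module ℝ E] {P : κ → Set E}
    {c : κ → ℝ} {q : E} :
    q ∈ ∑ i, c i • P i ↔ ∃ p : κ → E, (∀ i, p i ∈ P i) ∧ q = ∑ i, c i • p i := by
  rw [Set.mem_finsetSum]
  constructor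
  · rintro ⟨g, hg, rfl⟩
    choose p hp hpg using fun i => hg (Finset.mem_univ i)
    exact ⟨p, hp, Finset.sum_congr rfl fun i _ => (hpg i).symm⟩
  · rintro ⟨p, hp, rfl⟩
    exact ⟨_, fun {i} _ => Set.smul_mem_smul_set (hp i), rfl⟩

theorem maximizers_eq {E : Type*} {A : Set E} {f : E → ℝ} {c : ℝ} (hle : ∀ z ∈ A, f z ≤ c)
    (hex : ∃ z ∈ A, f z = c) : {z | z ∈ A ∧ ∀ w ∈ A, f w ≤ f z} = {z | z ∈ A ∧ f z = c} := by
  obtain ⟨z0, hz0, h0⟩ := hex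
  ext z
  exact and_congr_right fun hz => ⟨fun h => le_antisymm (hle z hz) (h0 ▸ h z0 hz0),
    fun h w hw => h ▸ hle w hw⟩

theorem isExposed_of_forall_le {E : Type*} [NormedAddCommGroup E] [NormedSpace ℝ E]
    [FiniteDimensional ℝ E] {A : Set E} (f : E →ₗ[ℝ] ℝ) {c : ℝ} (hle : ∀ z ∈ A, f z ≤ c) :
    IsExposed ℝ A {z | z ∈ A ∧ f z = c} := fun ⟨z, hz, hzc⟩ =>
  ⟨LinearMap.toContinuousLinearMap f, (maximizers_eq hle ⟨z, hz, hzc⟩).symm⟩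

/-! ### Points of dilated Cayley polytopes -/

variable {n l : ℕ}

/-- The embedding of `ℝⁿ` as `ℝⁿ × {eᵢ}`. -/
def lift (i : Fin l) (p : Fin n → ℝ) : Fin n ⊕ Fin l → ℝ := Sum.elim p (Pi.single i (1 : ℝ))

/-- The linear embedding of `ℝⁿ` as `ℝⁿ × {0}`. -/
def inlMap (n l : ℕ) : (Fin n → ℝ) →ₗ[ℝ] (Fin n ⊕ Fin l → ℝ) where
  toFun q := Sum.elim q 0
  map_add' p q := by ext (i | i) <;> simp
  map_smul' c q := by ext (i | i) <;> simp

/-- The linear functional `(q, c) ↦ a q + ∑ᵢ bᵢ cᵢ`. -/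
def sumFunctional (a : (Fin n → ℝ) →ₗ[ℝ] ℝ) (b : Fin l → ℝ) : (Fin n ⊕ Fin l → ℝ) →ₗ[ℝ] ℝ :=
  a ∘ₗ LinearMap.funLeft ℝ ℝ Sum.inl + ∑ i, b i • LinearMap.proj (Sum.inr i)

theorem sumFunctional_apply (a : (Fin n → ℝ) →ₗ[ℝ] ℝ) (b : Fin l → ℝ) (q : Fin n → ℝ)
    (c : Fin l → ℝ) : sumFunctional a b (Sum.elim q c) = a q + ∑ i, b i * c i := by
  simp only [sumFunctional, LinearMap.add_apply, LinearMap.comp_apply, LinearMap.sum_apply,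
    LinearMap.smul_apply, LinearMap.proj_apply, Sum.elim_inr, smul_eq_mul]
  rfl

/-- The functional `(q, c) ↦ ∑ᵢ cᵢ`. -/
def height (n l : ℕ) : (Fin n ⊕ Fin l → ℝ) →ₗ[ℝ] ℝ := sumFunctional 0 1

theorem height_elim (q : Fin n → ℝ) (c : Fin l → ℝ) :
    height n l (Sum.elim q c) = ∑ i, c i := by
  simp [height, sumFunctional_apply]

theorem height_lift (i : Fin l) (p : Fin n → ℝ) : height n l (lift i p) = 1 := by
  simp [lift, height_elim]

theorem sum_smul_lift (c : Fin l → ℝ) (p : Fin l → Fin n → ℝ) :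
    ∑ i, c i • lift i (p i) = Sum.elim (∑ i, c i • p i) c := by
  ext (j | j)
  · simp [lift]
  · simp [lift, Pi.single_apply]

theorem eq_sumFunctional (L : (Fin n ⊕ Fin l → ℝ) →ₗ[ℝ] ℝ) :
    L = sumFunctional (L ∘ₗ inlMap n l) fun i => L (lift i 0) := by
  refine LinearMap.ext fun z => ?_
  obtain ⟨q, c, rfl⟩ : ∃ q c, z = Sum.elim q c :=
    ⟨fun i => z (Sum.inl i), fun i => z (Sum.inr i), by ext (i | i) <;> rfl⟩
  have : (Sum.elim q c : Fin n ⊕ Fin l → ℝ) = inlMap n l q + ∑ i, c i • lift i 0 := by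
    rw [sum_smul_lift]
    ext (i | i) <;> simp [inlMap]
  rw [sumFunctional_apply]
  nth_rewrite 1 [this]
  simp [mul_comm]

theorem isLatticePoint_elim {q : Fin n → ℝ} {c : Fin l → ℝ} (hq : IsLatticePoint q)
    (hc : IsLatticePoint c) : IsLatticePoint (Sum.elim q c : Fin n ⊕ Fin l → ℝ) := by
  rintro (i | i)
  · exact hq i
  · exact hc i

theorem isLatticePoint_lift {p : Fin n → ℝ} (i : Fin l) (hp : IsLatticePoint p) :
    IsLatticePoint (lift i p) :=
  isLatticePoint_elim hp (isLatticePoint_single i)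

theorem lift_mem_cayley {P : Fin l → Set (Fin n → ℝ)} {i : Fin l} {p : Fin n → ℝ}
    (hp : p ∈ P i) : lift i p ∈ cayley P :=
  subset_convexHull ℝ _ (Set.mem_iUnion.2 ⟨i, p, hp, rfl⟩)

/-- For m = 1 the set described contains the generators, and it is convex because s cᵢ pᵢ + t dᵢ qᵢ
lies in (s cᵢ + t dᵢ) Pᵢ. Scaling gives the general case. -/
theorem mem_smul_cayley {P : Fin l → Set (Fin n → ℝ)} (hP : ∀ i, Convex ℝ (P i))
    (hne : ∀ i, (P i).Nonempty) {m : ℝ} (hm : 0 < m) {z : Fin n ⊕ Fin l → ℝ} :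
    z ∈ m • cayley P ↔ ∃ (c : Fin l → ℝ) (p : Fin l → Fin n → ℝ), (∀ i, 0 ≤ c i) ∧
      ∑ i, c i = m ∧ (∀ i, p i ∈ P i) ∧ z = Sum.elim (∑ i, c i • p i) c := by
  constructor
  · let A : Set (Fin n ⊕ Fin l → ℝ) := {z | ∃ (c : Fin l → ℝ) (p : Fin l → Fin n → ℝ),
      (∀ i, 0 ≤ c i) ∧ ∑ i, c i = 1 ∧ (∀ i, p i ∈ P i) ∧ z = Sum.elim (∑ i, c i • p i) c}
    have hA : Convex ℝ A := by
      rintro _ ⟨c, p, hc, hc1, hp, rfl⟩ _ ⟨d, q, hd, hd1, hq, rfl⟩ s t hs ht hst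
      choose r hr hrr using fun i => exists_smul_add_smul_eq (hP i) (hp i) (hq i)
        (mul_nonneg hs (hc i)) (mul_nonneg ht (hd i))
      refine ⟨fun i => s * c i + t * d i, r,
        fun i => add_nonneg (mul_nonneg hs (hc i)) (mul_nonneg ht (hd i)), ?_, hr, ?_⟩
      · rw [Finset.sum_add_distrib, ← Finset.mul_sum, ← Finset.mul_sum, hc1, hd1]
        simpa using hst
      · rw [← sum_smul_lift, ← sum_smul_lift, ← sum_smul_lift]
        simp only [Finset.smul_sum, ← Finset.sum_add_distrib]
        rw [sum_smul_lift]
        simp only [← hrr]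
        ext (j | j) <;> simp [lift, Finset.sum_apply, Finset.sum_add_distrib, mul_assoc,
          Pi.single_apply]
    have hsub : cayley P ⊆ A := by
      refine convexHull_min (Set.iUnion_subset fun i => ?_) hA
      rintro _ ⟨p, hp, rfl⟩
      choose p0 hp0 using hne
      refine ⟨Pi.single i 1, Function.update p0 i p, fun j => ?_, by simp, fun j => ?_, ?_⟩
      · by_cases h : j = i
        · subst h; simp
        · simp [h]
      · by_cases h : j = i
        · subst h; simpa using hp
        · simpa [h] using hp0 j
      · congr 1
        rw [Finset.sum_eq_single i] <;> simp +contextual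
    rintro ⟨y, hy, rfl⟩
    obtain ⟨c, p, hc, hc1, hp, rfl⟩ := hsub hy
    refine ⟨fun i => m * c i, p, fun i => mul_nonneg hm.le (hc i), ?_, hp, ?_⟩
    · rw [← Finset.mul_sum, hc1, mul_one]
    · ext (j | j)
      · simp [Finset.mul_sum, mul_assoc]
      · simp
  · rintro ⟨c, p, hc, hcm, hp, rfl⟩
    refine ⟨∑ i, (c i / m) • lift i (p i), ?_, ?_⟩
    · refine (convex_convexHull ℝ _).sum_mem (fun i _ => by have := hc i; positivity) ?_
        fun i _ => lift_mem_cayley (hp i)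
      rw [← Finset.sum_div, hcm, div_self hm.ne']
    · change m • _ = _
      rw [Finset.smul_sum, ← sum_smul_lift]
      exact Finset.sum_congr rfl fun i _ => by rw [smul_smul, mul_div_cancel₀ _ hm.ne']

theorem isLatticePolytope_cayley (hl : 1 ≤ l) {P : Fin l → Set (Fin n → ℝ)}
    (hP : ∀ i, IsLatticePolytope (P i)) : IsLatticePolytope (cayley P) := by
  classical
  choose S hS hSl hPS using hP
  refine ⟨Finset.univ.biUnion fun i => (S i).image (lift i), ?_, ?_, ?_⟩
  · obtain ⟨s, hs⟩ := hS ⟨0, hl⟩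
    exact ⟨lift ⟨0, hl⟩ s, Finset.mem_biUnion.2 ⟨_, Finset.mem_univ _,
      Finset.mem_image_of_mem _ hs⟩⟩
  · intro v hv
    obtain ⟨i, -, hv⟩ := Finset.mem_biUnion.1 hv
    obtain ⟨s, hs, rfl⟩ := Finset.mem_image.1 hv
    exact isLatticePoint_lift i (hSl i s hs)
  · have hpt : ∀ i, ∀ p ∈ P i, lift i p ∈ convexHull ℝ (lift i '' (S i : Set (Fin n → ℝ))) := by
      intro i p hp
      have hf : lift i = (fun v => v + lift i 0) ∘ inlMap n l := by
        ext p (j | j) <;> simp [lift, inlMap, Pi.single_apply]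
      let φ : (Fin n → ℝ) →ᵃ[ℝ] (Fin n ⊕ Fin l → ℝ) :=
        (inlMap n l).toAffineMap + AffineMap.const ℝ _ (lift i 0)
      have hφ : (φ : (Fin n → ℝ) → _) = lift i := by
        rw [hf]; rfl
      rw [← hφ, ← AffineMap.image_convexHull, ← hPS i]
      exact ⟨p, hp, rfl⟩
    apply subset_antisymm
    · refine convexHull_min (Set.iUnion_subset fun i => ?_) (convex_convexHull ℝ _)
      rintro _ ⟨p, hp, rfl⟩
      refine convexHull_mono ?_ (hpt i p hp)
      rintro _ ⟨s, hs, rfl⟩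
      exact Finset.mem_coe.2 (Finset.mem_biUnion.2 ⟨i, Finset.mem_univ _,
        Finset.mem_image_of_mem _ hs⟩)
    · refine convexHull_min ?_ (convex_convexHull ℝ _)
      intro v hv
      obtain ⟨i, -, hv⟩ := Finset.mem_biUnion.1 (Finset.mem_coe.1 hv)
      obtain ⟨s, hs, rfl⟩ := Finset.mem_image.1 hv
      exact lift_mem_cayley (hPS i ▸ subset_convexHull ℝ _ hs)

/-! ### Dimensions of Cayley polytopes -/

/-- The span is a direct sum of the direction spaces placed in ℝⁿ × {0} and the span of one lifted
point for each j in J; the latter points are independent through their coordinates eⱼ. Proper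
subsets J serve for the facets {zᵢ = 0}. -/
theorem finrank_span_lift (J : Finset (Fin l)) {Q : Fin l → Set (Fin n → ℝ)}
    (hQ : ∀ j, (Q j).Nonempty) :
    Module.finrank ℝ (Submodule.span ℝ (⋃ j ∈ J, lift j '' Q j)) =
      Module.finrank ℝ (⨆ j ∈ J, vectorSpan ℝ (Q j) : Submodule ℝ (Fin n → ℝ)) + J.card := by
  classical
  choose p hp using hQ
  set W : Submodule ℝ (Fin n → ℝ) := ⨆ j ∈ J, vectorSpan ℝ (Q j) with hW
  set T : Submodule ℝ (Fin n ⊕ Fin l → ℝ) :=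
    Submodule.span ℝ (Set.range fun j : J => lift (j : Fin l) (p j)) with hT
  have hli : LinearIndependent ℝ fun j : J => lift (j : Fin l) (p j) := by
    have h1 : LinearIndependent ℝ fun j : J => (Pi.single (j : Fin l) 1 : Fin l → ℝ) :=
      (Pi.linearIndependent_single_one (Fin l) ℝ).comp _ Subtype.val_injective
    exact LinearIndependent.of_comp (LinearMap.funLeft ℝ ℝ Sum.inr) h1
  have hTr : Module.finrank ℝ T = J.card := by
    rw [hT, finrank_span_eq_card hli, Fintype.card_coe]
  have hinj : Function.Injective (inlMap n l) := fun a b hab => by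
    ext j; exact congrFun hab (Sum.inl j)
  have hWr : Module.finrank ℝ (W.map (inlMap n l)) = Module.finrank ℝ W :=
    (Submodule.equivMapOfInjective _ hinj W).finrank_eq.symm
  have hsub : ∀ (j : Fin l) (a b : Fin n → ℝ), lift j a - lift j b = inlMap n l (a - b) := by
    intro j a b
    ext (i | i) <;> simp [lift, inlMap]
  have hspan : Submodule.span ℝ (⋃ j ∈ J, lift j '' Q j) = W.map (inlMap n l) ⊔ T := by
    apply le_antisymm
    · rw [Submodule.span_le]
      intro z hz
      simp only [Set.mem_iUnion] at hz
      obtain ⟨j, hj, q, hq, rfl⟩ := hz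
      have h1 : inlMap n l (q - p j) ∈ W.map (inlMap n l) :=
        Submodule.mem_map_of_mem ((le_iSup₂ (f := fun j _ => vectorSpan ℝ (Q j)) j hj)
          (vsub_mem_vectorSpan ℝ hq (hp j)))
      have h2 : lift j (p j) ∈ T := Submodule.subset_span ⟨⟨j, hj⟩, rfl⟩
      have := Submodule.add_mem_sup h1 h2
      rwa [← hsub, sub_add_cancel] at this
    · have hmem : ∀ j ∈ J, ∀ q ∈ Q j, lift j q ∈ Submodule.span ℝ (⋃ j ∈ J, lift j '' Q j) :=
        fun j hj q hq => Submodule.subset_span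
          (Set.mem_iUnion₂.2 ⟨j, hj, Set.mem_image_of_mem _ hq⟩)
      refine sup_le ?_ ?_
      · rw [Submodule.map_le_iff_le_comap, hW]
        refine iSup₂_le fun j hj => ?_
        rw [vectorSpan_def, Submodule.span_le]
        rintro _ ⟨a, ha, b, hb, rfl⟩
        change inlMap n l (a - b) ∈ Submodule.span ℝ (⋃ j ∈ J, lift j '' Q j)
        rw [← hsub j]
        exact sub_mem (hmem j hj a ha) (hmem j hj b hb)
      · rw [hT, Submodule.span_le]
        rintro _ ⟨j, rfl⟩
        exact hmem j j.2 _ (hp j)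
  have hinf : W.map (inlMap n l) ⊓ T = ⊥ := by
    rw [eq_bot_iff]
    rintro z ⟨⟨w, -, rfl⟩, hz⟩
    obtain ⟨c, hc⟩ := (Submodule.mem_span_range_iff_exists_fun ℝ).1 hz
    have hc0 : ∀ i : J, c i = 0 := by
      have h1 : LinearIndependent ℝ fun j : J => (Pi.single (j : Fin l) 1 : Fin l → ℝ) :=
        (Pi.linearIndependent_single_one (Fin l) ℝ).comp _ Subtype.val_injective
      refine Fintype.linearIndependent_iff.1 h1 c ?_
      have := congrArg (LinearMap.funLeft ℝ ℝ Sum.inr) hc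
      rw [map_sum] at this
      simp only [map_smul] at this
      exact this
    rw [← hc]
    simp [hc0]
  have := Submodule.finrank_sup_add_finrank_inf_eq (W.map (inlMap n l)) T
  rw [hinf, finrank_bot, ← hspan, hWr, hTr] at this
  simpa using this

theorem span_smul_cayley {m : ℝ} (hm : m ≠ 0) (Q : Fin l → Set (Fin n → ℝ)) :
    Submodule.span ℝ (m • cayley Q) = Submodule.span ℝ (⋃ j ∈ Finset.univ, lift j '' Q j) := by
  rw [Submodule.span_smul_eq_of_isUnit _ _ (IsUnit.mk0 m hm)]
  simp only [Finset.mem_univ, Set.iUnion_true]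
  apply le_antisymm
  · rw [Submodule.span_le]
    exact convexHull_min Submodule.subset_span (Submodule.convex _)
  · exact Submodule.span_mono (subset_convexHull ℝ _)

theorem height_of_mem_smul_cayley {m : ℝ} {Q : Fin l → Set (Fin n → ℝ)}
    {z : Fin n ⊕ Fin l → ℝ} (hz : z ∈ m • cayley Q) : height n l z = m := by
  obtain ⟨y, hy, rfl⟩ := hz
  have : cayley Q ⊆ {y | height n l y = 1} := by
    refine convexHull_min (Set.iUnion_subset fun i => ?_)
      (convex_hyperplane (height n l).isLinear 1)
    rintro _ ⟨p, hp, rfl⟩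
    exact height_lift i p
  have := this hy
  simp only [Set.mem_ofPred_eq] at this
  simp [this]

/-- Compared with `dim_sum_smul`, the excess l - 1 does not depend on Q. Codimension one is thus
preserved between faces of the sum and faces of the Cayley polytope. -/
theorem dim_smul_cayley_add_one (hl : 1 ≤ l) {m : ℝ} (hm : m ≠ 0)
    {Q : Fin l → Set (Fin n → ℝ)} (hQ : ∀ j, (Q j).Nonempty) :
    dim (m • cayley Q) + 1 =
      Module.finrank ℝ (⨆ j ∈ Finset.univ, vectorSpan ℝ (Q j) : Submodule ℝ (Fin n → ℝ)) + l := by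
  obtain ⟨q, hq⟩ := hQ ⟨0, hl⟩
  rw [dim_add_one (h := height n l) hm (fun z hz => height_of_mem_smul_cayley hz)
    ⟨_, Set.smul_mem_smul_set (lift_mem_cayley hq)⟩, span_smul_cayley hm,
    finrank_span_lift _ hQ, Finset.card_univ, Fintype.card_fin]

theorem dim_sum_smul {κ E : Type*} [Fintype κ] {Q : κ → Set (E → ℝ)}
    (hQ : ∀ j, (Q j).Nonempty) {c : κ → ℝ} (hc : ∀ j, c j ≠ 0) :
    dim (∑ j, c j • Q j) =
      Module.finrank ℝ (⨆ j ∈ Finset.univ, vectorSpan ℝ (Q j) : Submodule ℝ (E → ℝ)) := by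
  rw [dim, vectorSpan_sum_set _ fun j => (hQ j).smul_set,
    iSup_congr fun j => iSup_congr fun _ => vectorSpan_smul_set (hc j) (Q j)]

/-! ### Faces of weighted sums and of Cayley polytopes -/

section Face

variable {P : Fin l → Set (Fin n → ℝ)} {a : (Fin n → ℝ) →ₗ[ℝ] ℝ} {M : Fin l → ℝ}

/-- The faces of the `Pᵢ` on which `a` takes the value `Mᵢ`. -/
def face (P : Fin l → Set (Fin n → ℝ)) (a : (Fin n → ℝ) →ₗ[ℝ] ℝ) (M : Fin l → ℝ) (i : Fin l) :
    Set (Fin n → ℝ) := {p | p ∈ P i ∧ a p = M i}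

theorem convex_face (hP : ∀ i, Convex ℝ (P i)) (i : Fin l) : Convex ℝ (face P a M i) :=
  (hP i).inter (convex_hyperplane a.isLinear _)

/-- Equality in the summed bound forces cᵢ (Mᵢ - a pᵢ) = 0 for every i. Where cᵢ = 0 the point pᵢ
may lie off the face, but it contributes nothing and can be replaced. -/
theorem exists_mem_face_sum_eq (hM : ∀ i, ∀ p ∈ P i, a p ≤ M i)
    (hne : ∀ i, (face P a M i).Nonempty) {c : Fin l → ℝ} (hc : ∀ i, 0 ≤ c i)
    {p : Fin l → Fin n → ℝ} (hp : ∀ i, p i ∈ P i) (h : a (∑ i, c i • p i) = ∑ i, M i * c i) :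
    ∃ q : Fin l → Fin n → ℝ, (∀ i, q i ∈ face P a M i) ∧ ∑ i, c i • p i = ∑ i, c i • q i := by
  have hterm : ∀ i, c i * (M i - a (p i)) = 0 := by
    have hsum : ∑ i, c i * (M i - a (p i)) = 0 := by
      simp only [mul_sub, Finset.sum_sub_distrib]
      rw [map_sum] at h
      simp only [map_smul, smul_eq_mul] at h
      rw [h, sub_eq_zero]
      exact Finset.sum_congr rfl fun i _ => mul_comm _ _
    intro i
    exact (Finset.sum_eq_zero_iff_of_nonneg fun i _ =>
      mul_nonneg (hc i) (sub_nonneg.2 (hM i _ (hp i)))).1 hsum i (Finset.mem_univ i)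
  have : ∀ i, ∃ q ∈ face P a M i, c i • p i = c i • q := by
    intro i
    rcases mul_eq_zero.1 (hterm i) with h0 | h0
    · obtain ⟨q, hq⟩ := hne i
      exact ⟨q, hq, by simp [h0]⟩
    · exact ⟨p i, ⟨hp i, by linarith⟩, rfl⟩
  choose q hq hqq using this
  exact ⟨q, hq, Finset.sum_congr rfl fun i _ => hqq i⟩

theorem sum_smul_face (hM : ∀ i, ∀ p ∈ P i, a p ≤ M i) (hne : ∀ i, (face P a M i).Nonempty)
    {c : Fin l → ℝ} (hc : ∀ i, 0 ≤ c i) :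
    {q | q ∈ ∑ i, c i • P i ∧ a q = ∑ i, M i * c i} = ∑ i, c i • face P a M i := by
  ext q
  constructor
  · rintro ⟨hq, hqa⟩
    obtain ⟨p, hp, rfl⟩ := mem_sum_smul.1 hq
    exact mem_sum_smul.2 (exists_mem_face_sum_eq hM hne hc hp hqa)
  · intro hq
    obtain ⟨p, hp, rfl⟩ := mem_sum_smul.1 hq
    refine ⟨mem_sum_smul.2 ⟨p, fun i => (hp i).1, rfl⟩, ?_⟩
    simp [(hp _).2, mul_comm]

theorem le_of_mem_sum_smul (hM : ∀ i, ∀ p ∈ P i, a p ≤ M i) {c : Fin l → ℝ}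
    (hc : ∀ i, 0 ≤ c i) {q : Fin n → ℝ} (hq : q ∈ ∑ i, c i • P i) : a q ≤ ∑ i, M i * c i := by
  obtain ⟨p, hp, rfl⟩ := mem_sum_smul.1 hq
  rw [map_sum]
  refine Finset.sum_le_sum fun i _ => ?_
  rw [map_smul, smul_eq_mul, mul_comm]
  exact mul_le_mul_of_nonneg_right (hM i _ (hp i)) (hc i)

theorem smul_cayley_face (hP : ∀ i, Convex ℝ (P i)) (hM : ∀ i, ∀ p ∈ P i, a p ≤ M i)
    (hne : ∀ i, (face P a M i).Nonempty) {m : ℝ} (hm : 0 < m) :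
    {z | z ∈ m • cayley P ∧ sumFunctional a (-M) z = 0} = m • cayley (face P a M) := by
  have hPne : ∀ i, (P i).Nonempty := fun i => (hne i).mono fun p hp => hp.1
  ext z
  rw [mem_smul_cayley (convex_face hP) hne hm, Set.mem_ofPred_eq, mem_smul_cayley hP hPne hm]
  constructor
  · rintro ⟨⟨c, p, hc, hcm, hp, rfl⟩, h0⟩
    rw [sumFunctional_apply] at h0
    obtain ⟨q, hq, hqq⟩ := exists_mem_face_sum_eq hM hne hc hp (by
      simp only [Pi.neg_apply, neg_mul, Finset.sum_neg_distrib] at h0; linarith)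
    exact ⟨c, q, hc, hcm, hq, by rw [hqq]⟩
  · rintro ⟨c, p, hc, hcm, hp, rfl⟩
    refine ⟨⟨c, p, hc, hcm, fun i => (hp i).1, rfl⟩, ?_⟩
    rw [sumFunctional_apply]
    simp [(hp _).2, mul_comm]

theorem sumFunctional_nonpos_of_mem (hP : ∀ i, Convex ℝ (P i)) (hPne : ∀ i, (P i).Nonempty)
    (hM : ∀ i, ∀ p ∈ P i, a p ≤ M i) {m : ℝ} (hm : 0 < m) {z : Fin n ⊕ Fin l → ℝ}
    (hz : z ∈ m • cayley P) : sumFunctional a (-M) z ≤ 0 := by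
  obtain ⟨c, p, hc, hcm, hp, rfl⟩ := (mem_smul_cayley hP hPne hm).1 hz
  rw [sumFunctional_apply]
  have := le_of_mem_sum_smul hM hc (mem_sum_smul.2 ⟨p, hp, rfl⟩)
  simp only [Pi.neg_apply, neg_mul, Finset.sum_neg_distrib]
  linarith

end Face

/-! ### Relative interiors of Cayley polytopes -/

variable {P : Fin l → Set (Fin n → ℝ)}

/-- Prolonging past x from m times a lifted point of Pᵢ changes the coordinate cᵢ by ε (cᵢ - m),
which would make it negative if cᵢ were 0. Prolonging from a point with the same c stays in that
fibre. -/
theorem exists_eq_elim_of_mem_intrinsicInterior (hP : ∀ i, Convex ℝ (P i))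
    (hne : ∀ i, (P i).Nonempty) {m : ℝ} (hm : 0 < m) {x : Fin n ⊕ Fin l → ℝ}
    (hx : x ∈ intrinsicInterior ℝ (m • cayley P)) :
    ∃ (q : Fin n → ℝ) (c : Fin l → ℝ), x = Sum.elim q c ∧ (∀ i, 0 < c i) ∧ ∑ i, c i = m ∧
      q ∈ intrinsicInterior ℝ (∑ i, c i • P i) := by
  have hmem {z} := mem_smul_cayley hP hne hm (z := z)
  obtain ⟨c, p, hc, hcm, hp, rfl⟩ := hmem.1 (intrinsicInterior_subset hx)
  refine ⟨_, c, rfl, fun i => ?_, hcm, ?_⟩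
  · obtain ⟨p0, hp0⟩ := hne i
    obtain ⟨ε, hε, h⟩ := exists_extend_of_mem_intrinsicInterior hx
      (Set.smul_mem_smul_set (a := m) (lift_mem_cayley hp0))
    obtain ⟨d, p', hd, -, -, h⟩ := hmem.1 h
    have h1 := congrFun h (Sum.inr i)
    simp only [lift, Pi.add_apply, Pi.smul_apply, Pi.sub_apply, Sum.elim_inr, Pi.single_eq_same,
      smul_eq_mul, mul_one] at h1
    have := hd i
    have : 0 < ε * m := mul_pos hε hm
    by_contra! hneg
    nlinarith
  · refine mem_intrinsicInterior_of_forall_extend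
      (convex_sum _ fun i _ => (hP i).smul _) (mem_sum_smul.2 ⟨p, hp, rfl⟩) fun y hy => ?_
    obtain ⟨p', hp', rfl⟩ := mem_sum_smul.1 hy
    obtain ⟨ε, hε, h⟩ := exists_extend_of_mem_intrinsicInterior hx
      (hmem.2 ⟨c, p', hc, hcm, hp', rfl⟩)
    refine ⟨ε, hε, ?_⟩
    obtain ⟨d, r, hd, -, hr, h⟩ := hmem.1 h
    have hdc : d = c := by
      ext i
      have := congrFun h (Sum.inr i)
      simpa using this.symm
    refine mem_sum_smul.2 ⟨r, hr, ?_⟩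
    ext j
    have := congrFun h (Sum.inl j)
    rw [hdc] at this
    exact this

theorem elim_mem_intrinsicInterior (hP : ∀ i, Convex ℝ (P i)) (hne : ∀ i, (P i).Nonempty)
    {m : ℝ} (hm : 0 < m) {c : Fin l → ℝ} (hc : ∀ i, 1 ≤ c i) (hcm : ∑ i, c i = m)
    {q : Fin n → ℝ} (hq : q ∈ intrinsicInterior ℝ (∑ i, c i • P i)) :
    (Sum.elim q c : Fin n ⊕ Fin l → ℝ) ∈ intrinsicInterior ℝ (m • cayley P) := by
  have hmem {z} := mem_smul_cayley hP hne hm (z := z)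
  have hc0 : ∀ i, 0 ≤ c i := fun i => zero_le_one.trans (hc i)
  refine mem_intrinsicInterior_of_forall_extend ((convex_convexHull ℝ _).smul _) ?_ ?_
  · obtain ⟨p, hp, rfl⟩ := mem_sum_smul.1 (intrinsicInterior_subset hq)
    exact hmem.2 ⟨c, p, hc0, hcm, hp, rfl⟩
  · intro y hy
    obtain ⟨d, p, hd, hdm, hp, rfl⟩ := hmem.1 hy
    obtain ⟨δ, hδ, h⟩ := exists_extend_of_mem_intrinsicInterior hq
      (mem_sum_smul.2 ⟨p, hp, rfl⟩)
    obtain ⟨v, hv, hqv⟩ := mem_sum_smul.1 h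
    have hq' : q = (1 / (1 + δ)) • ∑ i, c i • v i + (δ / (1 + δ)) • ∑ i, c i • p i := by
      rw [← hqv]
      match_scalars <;> field_simp
      ring
    -- Chosen so that ε m = δ / (1 + δ): with dᵢ ≤ m and cᵢ ≥ 1 the coefficients of the pᵢ in `hβ`
    -- stay nonnegative when q + ε (q - ∑ dᵢ pᵢ) is expanded in the vᵢ and pᵢ.
    set ε := δ / ((1 + δ) * m) with hεdef
    have hε : 0 < ε := by positivity
    have hβ : ∀ i, 0 ≤ (1 + ε) * (δ / (1 + δ)) * c i - ε * d i := by
      intro i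
      have h1 : d i ≤ m := hdm ▸ Finset.single_le_sum (fun j _ => hd j) (Finset.mem_univ i)
      have h2 : ε * m = δ / (1 + δ) := by rw [hεdef]; field_simp
      have h3 : ε * d i ≤ δ / (1 + δ) := h2 ▸ mul_le_mul_of_nonneg_left h1 hε.le
      have h4 : 0 < δ / (1 + δ) := by positivity
      have h5 : δ / (1 + δ) * 1 ≤ (1 + ε) * (δ / (1 + δ)) * c i :=
        mul_le_mul (by nlinarith) (hc i) zero_le_one (by positivity)
      linarith
    have hα : ∀ i, 0 ≤ (1 + ε) * (1 / (1 + δ)) * c i := fun i =>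
      mul_nonneg (by positivity) (hc0 i)
    choose r hr hrr using fun i => exists_smul_add_smul_eq (hP i) (hv i) (hp i) (hα i) (hβ i)
    have hcoef : ∀ i, (1 + ε) * (1 / (1 + δ)) * c i + ((1 + ε) * (δ / (1 + δ)) * c i - ε * d i) =
        c i + ε * (c i - d i) := by
      intro i
      field_simp
      ring
    refine ⟨ε, hε, hmem.2 ⟨fun i => c i + ε * (c i - d i), r,
      fun i => (add_nonneg (hα i) (hβ i)).trans_eq (hcoef i), ?_, hr, ?_⟩⟩
    · rw [Finset.sum_add_distrib, ← Finset.mul_sum, Finset.sum_sub_distrib, hcm, hdm]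
      ring
    · have hsum : ∑ i, (c i + ε * (c i - d i)) • r i = q + ε • (q - ∑ i, d i • p i) := by
        simp only [← hcoef, ← hrr]
        have : q + ε • (q - ∑ i, d i • p i) = (1 + ε) • q - ε • ∑ i, d i • p i := by module
        rw [this, hq']
        simp only [Finset.smul_sum, ← Finset.sum_add_distrib, ← Finset.sum_sub_distrib]
        exact Finset.sum_congr rfl fun i _ => by module
      rw [hsum]
      ext (j | j) <;> simp

theorem span_smul_cayley_eq_top (hne : ∀ i, (P i).Nonempty)
    (hdim : Module.finrank ℝ
      (⨆ j ∈ Finset.univ, vectorSpan ℝ (P j) : Submodule ℝ (Fin n → ℝ)) = n) {m : ℝ}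
    (hm : m ≠ 0) : Submodule.span ℝ (m • cayley P) = ⊤ := by
  apply Submodule.eq_top_of_finrank_eq
  rw [span_smul_cayley hm, finrank_span_lift _ hne, hdim]
  simp

theorem mem_affineSpan_smul_cayley (hl : 1 ≤ l) (hne : ∀ i, (P i).Nonempty)
    (hdim : Module.finrank ℝ
      (⨆ j ∈ Finset.univ, vectorSpan ℝ (P j) : Submodule ℝ (Fin n → ℝ)) = n) {m : ℝ}
    (hm : m ≠ 0) {z : Fin n ⊕ Fin l → ℝ} (hz : height n l z = m) :
    z ∈ affineSpan ℝ (m • cayley P) := by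
  obtain ⟨p, hp⟩ := hne ⟨0, hl⟩
  exact mem_affineSpan_of_mem_span hm (fun z hz => height_of_mem_smul_cayley hz)
    ⟨_, Set.smul_mem_smul_set (lift_mem_cayley hp)⟩
    (span_smul_cayley_eq_top hne hdim hm ▸ Submodule.mem_top) hz

/-! ### From a reflexive dilate of the Cayley polytope to the weights -/

/-- The embedding of `ℝⁿ` as `ℝⁿ × {c}`. -/
def slice (c : Fin l → ℝ) : (Fin n → ℝ) →ᵃ[ℝ] (Fin n ⊕ Fin l → ℝ) :=
  (inlMap n l).toAffineMap + AffineMap.const ℝ _ (Sum.elim (0 : Fin n → ℝ) c)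

theorem slice_apply (c : Fin l → ℝ) (q : Fin n → ℝ) : slice c q = Sum.elim q c := by
  change inlMap n l q + Sum.elim (0 : Fin n → ℝ) c = _
  ext (j | j) <;> simp [inlMap]

/-- A functional exposing a facet G of the sum also selects faces of the Pᵢ, whose dilated Cayley
polytope is a facet containing G × {k}. Restricting its distance functional to the slice over k
serves G. -/
theorem isReflexive_sum_of_isReflexive_smul_cayley (hl : 1 ≤ l)
    (hP : ∀ i, IsLatticePolytope (P i))
    (hdim : Module.finrank ℝ
      (⨆ j ∈ Finset.univ, vectorSpan ℝ (P j) : Submodule ℝ (Fin n → ℝ)) = n) {m : ℕ}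
    (hm : 1 ≤ m) {k : Fin l → ℕ} (hk : ∀ i, 1 ≤ k i) (hkm : ∑ i, k i = m) {q : Fin n → ℝ}
    (hq : q ∈ intrinsicInterior ℝ (∑ i, (k i : ℝ) • P i)) (hql : IsLatticePoint q)
    (hdist : ∀ F, IsFacet ((m : ℝ) • cayley P) F →
      HasLatticeDistance ((m : ℝ) • cayley P) F (Sum.elim q fun i => (k i : ℝ)) 1) :
    IsReflexive (∑ i, (k i : ℝ) • P i) := by
  have hm0 : (0 : ℝ) < m := by exact_mod_cast hm
  have hk0 : ∀ i, (k i : ℝ) ≠ 0 := fun i => by have := hk i; positivity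
  have hk0' : ∀ i, (0 : ℝ) ≤ k i := fun i => by positivity
  have hkm' : ∑ i, (k i : ℝ) = m := by exact_mod_cast hkm
  have hkl : IsLatticePoint fun i => (k i : ℝ) := fun i => ⟨k i, by simp⟩
  have hR : IsLatticePolytope (∑ i, (k i : ℝ) • P i) :=
    IsLatticePolytope.sum _ fun i _ => (hP i).natCast_smul _
  refine ⟨hR, q, hq, hql, fun G hGfac => ?_⟩
  obtain ⟨hGne, hGexp, hGdim⟩ := hGfac
  obtain ⟨L, hL⟩ := hGexp hGne
  choose p hp hpl hmax using fun i => (hP i).exists_isMaxOn (L : (Fin n → ℝ) →ₗ[ℝ] ℝ)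
  set a : (Fin n → ℝ) →ₗ[ℝ] ℝ := (L : (Fin n → ℝ) →ₗ[ℝ] ℝ) with ha
  set M : Fin l → ℝ := fun i => a (p i) with hM
  have hface : ∀ i, (face P a M i).Nonempty := fun i => ⟨p i, hp i, rfl⟩
  have hG : G = ∑ i, (k i : ℝ) • face P a M i := by
    rw [hL, ← sum_smul_face hmax hface hk0']
    refine maximizers_eq (f := L) (fun z hz => le_of_mem_sum_smul hmax hk0' hz)
      ⟨_, mem_sum_smul.2 ⟨p, hp, rfl⟩, ?_⟩
    change a _ = _
    simp [mul_comm]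
  have hPne := fun i => (hP i).nonempty
  have hPc := fun i => (hP i).convex
  have hFfac : IsFacet ((m : ℝ) • cayley P) ((m : ℝ) • cayley (face P a M)) := by
    refine ⟨⟨_, Set.smul_mem_smul_set (lift_mem_cayley (i := ⟨0, hl⟩) ⟨hp _, rfl⟩)⟩, ?_, ?_⟩
    · rw [← smul_cayley_face hPc hmax hface hm0]
      exact isExposed_of_forall_le _ fun z hz =>
        sumFunctional_nonpos_of_mem hPc hPne hmax hm0 hz
    · have h1 := dim_smul_cayley_add_one hl hm0.ne' hface
      have h2 := dim_smul_cayley_add_one hl hm0.ne' hPne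
      rw [hG, dim_sum_smul hface hk0, dim_sum_smul hPne hk0, hdim] at hGdim
      rw [hdim] at h2
      omega
  obtain ⟨u, ⟨huint, -⟩, hu⟩ := hdist _ hFfac
  refine hasLatticeDistance_one hR ⟨hGne, hGexp, hGdim⟩
    (subset_affineSpan ℝ _ (intrinsicInterior_subset hq)) hql
    (u.comp (slice fun i => (k i : ℝ))) ?_ ?_
  · intro y _ hyl
    rw [AffineMap.comp_apply, slice_apply]
    exact huint _ (mem_affineSpan_smul_cayley hl hPne hdim hm0.ne'
      (by rw [height_elim, hkm'])) (isLatticePoint_elim hyl hkl)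
  · intro y hy
    rw [AffineMap.comp_apply, AffineMap.comp_apply, slice_apply, slice_apply]
    rw [hG] at hy
    obtain ⟨p', hp', rfl⟩ := mem_sum_smul.1 hy
    exact hu _ ((mem_smul_cayley (convex_face hPc) hface hm0).2 ⟨_, p', hk0', hkm', hp', rfl⟩)

/-- If omitting `Pᵢ` keeps the dimension, then `{zᵢ = 0}` is a facet of `m (P₁ * ⋯ * Pₗ)`, and
distance one from it forces `xᵢ = 1`. -/
theorem eq_one_of_forall_hasLatticeDistance (hl : 1 ≤ l)
    (hP : ∀ i, IsLatticePolytope (P i))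
    (hdim : Module.finrank ℝ
      (⨆ j ∈ Finset.univ, vectorSpan ℝ (P j) : Submodule ℝ (Fin n → ℝ)) = n) {m : ℕ}
    (hm : 1 ≤ m) (hcard : 2 ≤ n + l) {x : Fin n ⊕ Fin l → ℝ}
    (hxP : x ∈ (m : ℝ) • cayley P) (hxl : IsLatticePoint x)
    (hdist : ∀ F, IsFacet ((m : ℝ) • cayley P) F →
      HasLatticeDistance ((m : ℝ) • cayley P) F x 1) {i : Fin l} {k : ℕ}
    (hk : x (Sum.inr i) = k)
    (hi : Module.finrank ℝ
      (⨆ j ∈ Finset.univ.erase i, vectorSpan ℝ (P j) : Submodule ℝ (Fin n → ℝ)) = n) :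
    k = 1 := by
  have hm0 : (0 : ℝ) < m := by exact_mod_cast hm
  have hPne := fun i => (hP i).nonempty
  have hPc := fun i => (hP i).convex
  have hcardJ : (Finset.univ.erase i).card = l - 1 := by
    rw [Finset.card_erase_of_mem (Finset.mem_univ i), Finset.card_univ, Fintype.card_fin]
  -- For l = 1 no summand remains, so `hi` gives n = 0, against `hcard`.
  have hl2 : 2 ≤ l := by
    by_contra! hlt
    have hemp : (Finset.univ.erase i : Finset (Fin l)) = ∅ := by
      rw [← Finset.card_eq_zero]; omega
    have hbot : (⨆ j ∈ Finset.univ.erase i, vectorSpan ℝ (P j) : Submodule ℝ (Fin n → ℝ)) = ⊥ := by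
      simp [hemp]
    rw [hbot, finrank_bot] at hi
    omega
  obtain ⟨j, hj⟩ : (Finset.univ.erase i).Nonempty := by
    rw [← Finset.card_pos]; omega
  have hji : j ≠ i := Finset.ne_of_mem_erase hj
  let π : (Fin n ⊕ Fin l → ℝ) →ₗ[ℝ] ℝ := LinearMap.proj (Sum.inr i)
  have hπ : ∀ z, π z = z (Sum.inr i) := fun z => rfl
  have hπle : ∀ z ∈ (m : ℝ) • cayley P, (-π) z ≤ 0 := by
    intro z hz
    obtain ⟨c, p, hc, -, -, rfl⟩ := (mem_smul_cayley hPc hPne hm0).1 hz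
    simpa [hπ] using hc i
  set F : Set (Fin n ⊕ Fin l → ℝ) := {z | z ∈ (m : ℝ) • cayley P ∧ (-π) z = 0} with hF
  have hmemF : ∀ t ≠ i, ∀ p ∈ P t, (m : ℝ) • lift t p ∈ F := fun t ht p hp =>
    ⟨Set.smul_mem_smul_set (lift_mem_cayley hp), by simp [hπ, lift, ht.symm]⟩
  obtain ⟨s, hs, hsl, -⟩ := (hP j).exists_isMaxOn 0
  have hsF := hmemF j hji s hs
  have hFh : ∀ z ∈ F, height n l z = m := fun z hz => height_of_mem_smul_cayley hz.1
  have hle1 : Submodule.span ℝ (⋃ t ∈ Finset.univ.erase i, lift t '' P t) ≤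
      Submodule.span ℝ F := by
    rw [Submodule.span_le]
    intro z hz
    simp only [Set.mem_iUnion] at hz
    obtain ⟨t, ht, p, hp, rfl⟩ := hz
    have := Submodule.smul_mem _ (m : ℝ)⁻¹ (Submodule.subset_span
      (hmemF t (Finset.ne_of_mem_erase ht) p hp) : _ ∈ Submodule.span ℝ F)
    rwa [inv_smul_smul₀ hm0.ne'] at this
  have hle2 : Submodule.span ℝ F ≤ LinearMap.ker π := by
    rw [Submodule.span_le]
    intro z hz
    have := hz.2
    simpa using this
  -- The span of F is squeezed between a space of rank n + l - 1 and the proper subspace ker π, so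
  -- it equals ker π.
  have hr1 := Submodule.finrank_mono hle1
  rw [finrank_span_lift _ hPne, hi, hcardJ] at hr1
  have hr2 : Module.finrank ℝ (LinearMap.ker π) < n + l := by
    have : Module.finrank ℝ (Fin n ⊕ Fin l → ℝ) = n + l := by simp
    rw [← this]
    refine Submodule.finrank_lt fun htop => ?_
    have h0 : lift i (0 : Fin n → ℝ) ∈ LinearMap.ker π := htop ▸ Submodule.mem_top
    simp [hπ, lift] at h0
  have hr3 := Submodule.finrank_mono hle2
  have hker : Submodule.span ℝ F = LinearMap.ker π :=
    Submodule.eq_of_le_of_finrank_le hle2 (by omega)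
  have hFfac : IsFacet ((m : ℝ) • cayley P) F := by
    refine ⟨⟨_, hsF⟩, isExposed_of_forall_le _ hπle, ?_⟩
    have h1 := dim_add_one hm0.ne' hFh ⟨_, hsF⟩
    have h2 := dim_smul_cayley_add_one hl hm0.ne' hPne
    rw [hdim] at h2
    omega
  obtain ⟨u, ⟨huint, -⟩, hu⟩ := hdist F hFfac
  obtain ⟨g, hg⟩ := exists_linear_eq_on_level u (height n l) hm0.ne'
  let φ : (Fin n ⊕ Fin l → ℝ) →ₗ[ℝ] ℝ := g - ((1 + u x) / m) • height n l
  have hφ : ∀ z, height n l z = m → φ z = u z - (1 + u x) := by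
    intro z hz
    simp only [φ, LinearMap.sub_apply, LinearMap.smul_apply, hz, hg z hz, smul_eq_mul]
    field_simp
  have hφF : Submodule.span ℝ F ≤ LinearMap.ker φ := by
    rw [Submodule.span_le]
    intro z hz
    rw [SetLike.mem_coe, LinearMap.mem_ker, hφ z (hFh z hz), ← hu z hz]
    ring
  -- φ vanishes on the span of F, which is the kernel of the i-th weight coordinate, so it is a
  -- multiple of that coordinate.
  have hφπ : ∀ z, φ z = z (Sum.inr i) * φ (lift i 0) := by
    intro z
    have h0 : z - z (Sum.inr i) • lift i 0 ∈ LinearMap.ker φ := by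
      apply hφF
      rw [hker, LinearMap.mem_ker]
      simp [hπ, lift]
    rw [LinearMap.mem_ker, map_sub, map_smul, smul_eq_mul, sub_eq_zero] at h0
    exact h0
  have haff {z} (hz : height n l z = m) := mem_affineSpan_smul_cayley hl hPne hdim hm0.ne' hz
  -- A lattice point of height m with i-th weight 1, not necessarily in the polytope. It shows that
  -- the multiple is an integer; since φ x = -1, the integer k then divides 1.
  set w : Fin n ⊕ Fin l → ℝ := (m : ℝ) • lift j s + (lift i 0 - lift j 0) with hw
  have hwh : height n l w = m := by simp [hw, height_lift]
  have hwl : IsLatticePoint w := ((isLatticePoint_lift j hsl).natCast_smul m).add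
    ((isLatticePoint_lift i isLatticePoint_zero).sub (isLatticePoint_lift j isLatticePoint_zero))
  have hwi : w (Sum.inr i) = 1 := by simp [hw, lift, hji.symm]
  have hxh : height n l x = m := height_of_mem_smul_cayley hxP
  obtain ⟨A, hA⟩ := huint w (haff hwh) hwl
  obtain ⟨B, hB⟩ := huint x (haff hxh) hxl
  have h1 : φ (lift i 0) = A - (1 + B) := by
    rw [← hA, ← hB, ← hφ w hwh, hφπ w, hwi, one_mul]
  have h2 : (k : ℝ) * (A - (1 + B)) = -1 := by
    rw [← h1, ← hk, ← hφπ x, hφ x hxh]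
    ring
  have h3 : (k : ℤ) * (A - (1 + B)) = -1 := by exact_mod_cast h2
  have h4 : (k : ℤ) ∣ 1 := ⟨-(A - (1 + B)), by linarith⟩
  have h5 := Int.eq_one_of_dvd_one (by positivity) h4
  exact_mod_cast h5

/-- The weights k are the last l coordinates of the interior lattice point; being integral and
positive, they are at least 1. -/
theorem exists_of_isReflexive_smul_cayley (hl : 1 ≤ l) (hP : ∀ i, IsLatticePolytope (P i))
    (hdim : Module.finrank ℝ
      (⨆ j ∈ Finset.univ, vectorSpan ℝ (P j) : Submodule ℝ (Fin n → ℝ)) = n) {m : ℕ}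
    (hm : 1 ≤ m) (hcard : 2 ≤ n + l ∨ m = 1) (href : IsReflexive ((m : ℝ) • cayley P)) :
    ∃ k : Fin l → ℕ, (∀ i, 1 ≤ k i) ∧ ∑ i, k i = m ∧ IsReflexive (∑ i, (k i : ℝ) • P i) ∧
      ∀ i, 2 ≤ k i → dim (∑ j ∈ Finset.univ.erase i, P j) < n := by
  have hm0 : (0 : ℝ) < m := by exact_mod_cast hm
  obtain ⟨-, x, hx, hxl, hdist⟩ := href
  obtain ⟨q, c, rfl, hc, hcm, hq⟩ := exists_eq_elim_of_mem_intrinsicInterior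
    (fun i => (hP i).convex) (fun i => (hP i).nonempty) hm0 hx
  have hck : ∀ i, ∃ k : ℕ, 1 ≤ k ∧ c i = k := by
    intro i
    obtain ⟨z, hz⟩ := hxl (Sum.inr i)
    rw [Sum.elim_inr] at hz
    have hpos : 0 < z := by
      have := hc i
      rw [hz] at this
      exact_mod_cast this
    refine ⟨z.toNat, by omega, ?_⟩
    rw [hz, ← Int.cast_natCast, Int.toNat_of_nonneg hpos.le]
  choose k hk hck using hck
  obtain rfl : c = fun i => (k i : ℝ) := funext hck
  have hkm : ∑ i, k i = m := by
    simp only at hcm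
    exact_mod_cast hcm
  refine ⟨k, hk, hkm, isReflexive_sum_of_isReflexive_smul_cayley hl hP hdim hm hk hkm hq
    (fun i => hxl (Sum.inl i)) hdist, fun i hi => ?_⟩
  rw [dim, vectorSpan_sum_set _ fun i => (hP i).nonempty]
  by_contra! hge
  have hle : k i ≤ m := hkm ▸ Finset.single_le_sum (fun j _ => Nat.zero_le _) (Finset.mem_univ i)
  rcases hcard with hcard | rfl
  · have hupper := Submodule.finrank_le
      (⨆ j ∈ Finset.univ.erase i, vectorSpan ℝ (P j) : Submodule ℝ (Fin n → ℝ))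
    rw [Module.finrank_fin_fun] at hupper
    have := eq_one_of_forall_hasLatticeDistance hl hP hdim hm hcard
      (intrinsicInterior_subset hx) hxl hdist (i := i) (k := k i) rfl (le_antisymm hupper hge)
    omega
  · omega

/-! ### From the weights to a reflexive dilate of the Cayley polytope -/

/-- A facet of `m (P₁ * ⋯ * Pₗ)` on which some coordinate `zᵢ` vanishes. -/
theorem le_finrank_of_isFacet_of_forall_eq_zero (hl : 1 ≤ l) (hP : ∀ i, Convex ℝ (P i))
    (hne : ∀ i, (P i).Nonempty)
    (hdim : Module.finrank ℝ
      (⨆ j ∈ Finset.univ, vectorSpan ℝ (P j) : Submodule ℝ (Fin n → ℝ)) = n) {m : ℝ}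
    (hm : 0 < m) {F : Set (Fin n ⊕ Fin l → ℝ)} (hF : IsFacet (m • cayley P) F) {i : Fin l}
    (hi : ∀ z ∈ F, z (Sum.inr i) = 0) :
    n ≤ Module.finrank ℝ
      (⨆ j ∈ Finset.univ.erase i, vectorSpan ℝ (P j) : Submodule ℝ (Fin n → ℝ)) := by
  have hsub : Submodule.span ℝ F ≤
      Submodule.span ℝ (⋃ t ∈ Finset.univ.erase i, lift t '' P t) := by
    rw [Submodule.span_le]
    intro z hz
    have hz0 := hi z hz
    obtain ⟨c, p, hc, -, hp, rfl⟩ := (mem_smul_cayley hP hne hm).1 (hF.2.1.subset hz)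
    rw [← sum_smul_lift]
    refine Submodule.sum_mem _ fun t _ => ?_
    by_cases ht : t = i
    · subst ht
      have : c t = 0 := hz0
      simp [this]
    · exact Submodule.smul_mem _ _ (Submodule.subset_span (Set.mem_iUnion₂.2
        ⟨t, Finset.mem_erase.2 ⟨ht, Finset.mem_univ t⟩, Set.mem_image_of_mem _ (hp t)⟩))
  have h1 := Submodule.finrank_mono hsub
  rw [finrank_span_lift _ hne, Finset.card_erase_of_mem (Finset.mem_univ i), Finset.card_univ,
    Fintype.card_fin] at h1
  have h2 := dim_add_one hm.ne'
    (fun z hz => height_of_mem_smul_cayley (hF.2.1.subset hz)) hF.1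
  have h3 := dim_smul_cayley_add_one hl hm.ne' hne
  have h4 := hF.2.2
  rw [hdim] at h3
  omega

/-- Distance one from a facet of `∑ kᵢ Pᵢ` lifts to the Cayley polytope. -/
theorem hasLatticeDistance_smul_cayley_face (hl : 1 ≤ l) (hP : ∀ i, IsLatticePolytope (P i))
    (hdim : Module.finrank ℝ
      (⨆ j ∈ Finset.univ, vectorSpan ℝ (P j) : Submodule ℝ (Fin n → ℝ)) = n) {m : ℕ}
    (hm : 1 ≤ m) {k : Fin l → ℕ} (hk : ∀ i, 1 ≤ k i) {q : Fin n → ℝ}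
    (hxl : IsLatticePoint (Sum.elim q fun i => (k i : ℝ)))
    (hxP : (Sum.elim q fun i => (k i : ℝ)) ∈ (m : ℝ) • cayley P)
    (hdist : ∀ G, IsFacet (∑ i, (k i : ℝ) • P i) G →
      HasLatticeDistance (∑ i, (k i : ℝ) • P i) G q 1)
    {a : (Fin n → ℝ) →ₗ[ℝ] ℝ} {M : Fin l → ℝ} (hM : ∀ i, ∀ p ∈ P i, a p ≤ M i)
    {p : Fin l → Fin n → ℝ} (hp : ∀ i, p i ∈ face P a M i) (hpl : ∀ i, IsLatticePoint (p i))
    (hF : IsFacet ((m : ℝ) • cayley P) ((m : ℝ) • cayley (face P a M))) :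
    HasLatticeDistance ((m : ℝ) • cayley P) ((m : ℝ) • cayley (face P a M))
      (Sum.elim q fun i => (k i : ℝ)) 1 := by
  have hm0 : (0 : ℝ) < m := by exact_mod_cast hm
  have hk0 : ∀ i, (k i : ℝ) ≠ 0 := fun i => by have := hk i; positivity
  have hk0' : ∀ i, (0 : ℝ) ≤ k i := fun i => by positivity
  have hPne := fun i => (hP i).nonempty
  have hPc := fun i => (hP i).convex
  have hface : ∀ i, (face P a M i).Nonempty := fun i => ⟨p i, hp i⟩
  have hGfac : IsFacet (∑ i, (k i : ℝ) • P i) (∑ i, (k i : ℝ) • face P a M i) := by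
    refine ⟨⟨_, mem_sum_smul.2 ⟨p, hp, rfl⟩⟩, ?_, ?_⟩
    · rw [← sum_smul_face hM hface hk0']
      exact isExposed_of_forall_le a fun z hz => le_of_mem_sum_smul hM hk0' hz
    · have h1 := dim_smul_cayley_add_one hl hm0.ne' hface
      have h2 := dim_smul_cayley_add_one hl hm0.ne' hPne
      have h3 := hF.2.2
      rw [dim_sum_smul hface hk0, dim_sum_smul hPne hk0, hdim]
      rw [hdim] at h2
      omega
  obtain ⟨u, ⟨huint, -⟩, hu⟩ := hdist _ hGfac
  have hlin : ∀ y y', u y - u y' = u.linear (y - y') := fun y y' => by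
    rw [← vsub_eq_sub y y', u.linearMap_vsub, vsub_eq_sub]
  set A := u.linear with hA
  have haff : ∀ y, y ∈ affineSpan ℝ (∑ i, (k i : ℝ) • P i) := by
    have hRne : (∑ i, (k i : ℝ) • P i).Nonempty :=
      ⟨_, mem_sum_smul.2 ⟨p, fun i => (hp i).1, rfl⟩⟩
    have htop : vectorSpan ℝ (∑ i, (k i : ℝ) • P i) = ⊤ := by
      apply Submodule.eq_top_of_finrank_eq
      have := dim_sum_smul hPne hk0
      rw [dim, hdim] at this
      rw [this, Module.finrank_fin_fun]
    rw [(AffineSubspace.affineSpan_eq_top_iff_vectorSpan_eq_top_of_nonempty ℝ _ _ hRne).2 htop]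
    exact fun y => AffineSubspace.mem_top ℝ _ y
  have hAint : ∀ y, IsLatticePoint y → ∃ z : ℤ, A y = z := by
    intro y hy
    obtain ⟨s, hs⟩ := huint y (haff y) hy
    obtain ⟨t, ht⟩ := huint 0 (haff 0) isLatticePoint_zero
    refine ⟨s - t, ?_⟩
    have := hlin y 0
    rw [sub_zero, hs, ht] at this
    rw [← this]; push_cast; ring
  set α : Fin l → ℝ := fun i => A (p i) with hα
  -- u is constant on the sum of faces, so exchanging a single summand pᵢ for v does not change it;
  -- kᵢ ≠ 0 then gives A v = A pᵢ.
  have hAface : ∀ i, ∀ v ∈ face P a M i, A v = α i := by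
    intro i v hv
    have h1 := hu _ (mem_sum_smul.2 ⟨p, hp, rfl⟩)
    have h2 := hu _ (mem_sum_smul.2 ⟨Function.update p i v, fun j => by
      by_cases h : j = i
      · subst h; simpa using hv
      · simpa [h] using hp j, rfl⟩)
    have h3 : A (∑ j, (k j : ℝ) • Function.update p i v j - ∑ j, (k j : ℝ) • p j) = 0 := by
      rw [← hlin]; linarith
    rw [← Finset.sum_sub_distrib, Finset.sum_eq_single i (fun j _ hj => by simp [hj])
      (by simp), Function.update_self, ← smul_sub, map_smul, smul_eq_mul, map_sub] at h3
    exact sub_eq_zero.1 ((mul_eq_zero.1 h3).resolve_left (hk0 i))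
  -- The functional (v, c) ↦ A v - ∑ cᵢ A pᵢ vanishes on the lifted facet and equals A (q - ∑ kᵢ pᵢ)
  -- = -1 at (q, k). It is integral because the pᵢ are lattice points.
  refine hasLatticeDistance_one ((isLatticePolytope_cayley hl hP).natCast_smul m) hF
    (subset_affineSpan ℝ _ hxP) hxl (sumFunctional A (-α)).toAffineMap ?_ ?_
  · intro z _ hz
    have hz' : z = Sum.elim (fun i => z (Sum.inl i)) fun i => z (Sum.inr i) := by
      ext (i | i) <;> rfl
    obtain ⟨s, hs⟩ := hAint (fun i => z (Sum.inl i)) fun i => hz (Sum.inl i)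
    choose t ht using fun i => hAint (p i) (hpl i)
    choose d hd using fun i => hz (Sum.inr i)
    refine ⟨s + ∑ i, -t i * d i, ?_⟩
    rw [hz', LinearMap.coe_toAffineMap, sumFunctional_apply, hs]
    simp [hα, ht, hd]
  · intro y hy
    obtain ⟨c, v, hc, -, hv, rfl⟩ := (mem_smul_cayley (convex_face hPc) hface hm0).1 hy
    rw [LinearMap.coe_toAffineMap, sumFunctional_apply, sumFunctional_apply]
    have h1 := hu _ (mem_sum_smul.2 ⟨p, hp, rfl⟩)
    rw [hlin, map_sub, map_sum] at h1
    rw [map_sum]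
    simp only [map_smul, smul_eq_mul, hAface _ _ (hv _), Pi.neg_apply, neg_mul,
      Finset.sum_neg_distrib] at h1 ⊢
    simp only [hα, mul_comm] at h1 ⊢
    linarith

/-- Facets split into two kinds according to whether the exposing functional attains the same
maximum Mᵢ + bᵢ over every lifted Pᵢ. The first kind comes from facets of the sum, the second lies
in a coordinate hyperplane and is handled by `hcond`. -/
theorem isReflexive_smul_cayley (hl : 1 ≤ l) (hP : ∀ i, IsLatticePolytope (P i))
    (hdim : Module.finrank ℝ
      (⨆ j ∈ Finset.univ, vectorSpan ℝ (P j) : Submodule ℝ (Fin n → ℝ)) = n)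
    {k : Fin l → ℕ} (hk : ∀ i, 1 ≤ k i) {m : ℕ} (hkm : ∑ i, k i = m) (hm : 1 ≤ m)
    (href : IsReflexive (∑ i, (k i : ℝ) • P i))
    (hcond : ∀ i, 2 ≤ k i → dim (∑ j ∈ Finset.univ.erase i, P j) < n) :
    IsReflexive ((m : ℝ) • cayley P) := by
  have hm0 : (0 : ℝ) < m := by exact_mod_cast hm
  have hkm' : ∑ i, (k i : ℝ) = m := by exact_mod_cast hkm
  have hPne := fun i => (hP i).nonempty
  have hPc := fun i => (hP i).convex
  have hlat := (isLatticePolytope_cayley hl hP).natCast_smul m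
  obtain ⟨-, q, hq, hql, hdist⟩ := href
  have hxl : IsLatticePoint (Sum.elim q fun i => (k i : ℝ)) :=
    isLatticePoint_elim hql fun i => ⟨k i, by simp⟩
  have hx := elim_mem_intrinsicInterior hPc hPne hm0
    (c := fun i => (k i : ℝ)) (fun i => by exact_mod_cast hk i) hkm' hq
  have hxP := intrinsicInterior_subset hx
  refine ⟨hlat, _, hx, hxl, fun F hF => ?_⟩
  obtain ⟨L, hL⟩ := hF.2.1 hF.1
  obtain ⟨a, b, hab⟩ : ∃ (a : (Fin n → ℝ) →ₗ[ℝ] ℝ) (b : Fin l → ℝ),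
      (L : (Fin n ⊕ Fin l → ℝ) →ₗ[ℝ] ℝ) = sumFunctional a b := ⟨_, _, eq_sumFunctional _⟩
  have hLapp : ∀ v c, L (Sum.elim v c) = a v + ∑ i, b i * c i := fun v c => by
    rw [← sumFunctional_apply, ← hab]; rfl
  choose p hp hpl hmax using fun i => (hP i).exists_isMaxOn a
  set M : Fin l → ℝ := fun i => a (p i) with hM
  obtain ⟨j₀, -, hj₀⟩ := Finset.univ.exists_max_image (fun i => M i + b i)
    ⟨⟨0, hl⟩, Finset.mem_univ _⟩
  set B := M j₀ + b j₀ with hB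
  have hj₀' : ∀ i, M i + b i ≤ B := fun i => hj₀ i (Finset.mem_univ i)
  -- The subtracted sum is the loss from putting weight on indices where Mᵢ + bᵢ falls short of B.
  -- On F it vanishes term by term, so such weights are zero there.
  have hLle : ∀ (c : Fin l → ℝ) (v : Fin l → Fin n → ℝ), (∀ i, 0 ≤ c i) → ∑ i, c i = m →
      (∀ i, v i ∈ P i) →
      L (Sum.elim (∑ i, c i • v i) c) ≤ m * B - ∑ i, c i * (B - (M i + b i)) := by
    intro c v hc hcm hv
    rw [hLapp]
    have h1 := le_of_mem_sum_smul hmax hc (mem_sum_smul.2 ⟨v, hv, rfl⟩)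
    have h2 : m * B - ∑ i, c i * (B - (M i + b i)) = ∑ i, M i * c i + ∑ i, b i * c i := by
      rw [← hcm, Finset.sum_mul, ← Finset.sum_sub_distrib, ← Finset.sum_add_distrib]
      exact Finset.sum_congr rfl fun i _ => by ring
    rw [h2]
    linarith
  have hterm : ∀ c : Fin l → ℝ, (∀ i, 0 ≤ c i) → ∀ i, 0 ≤ c i * (B - (M i + b i)) :=
    fun c hc i => mul_nonneg (hc i) (sub_nonneg.2 (hj₀' i))
  have hFeq : F = {z | z ∈ (m : ℝ) • cayley P ∧ L z = m * B} := by
    rw [hL]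
    refine maximizers_eq (f := L) (fun z hz => ?_)
      ⟨_, Set.smul_mem_smul_set (lift_mem_cayley (hp j₀)), ?_⟩
    · obtain ⟨c, v, hc, hcm, hv, rfl⟩ := (mem_smul_cayley hPc hPne hm0).1 hz
      have h1 := hLle c v hc hcm hv
      have h2 := Finset.sum_nonneg fun i (_ : i ∈ Finset.univ) => hterm c hc i
      linarith
    · rw [map_smul, lift, hLapp]
      simp [hB, hM, Pi.single_apply]
  by_cases hall : ∀ i, M i + b i = B
  · have hface : ∀ i, p i ∈ face P a M i := fun i => ⟨hp i, rfl⟩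
    have hFeq' : F = (m : ℝ) • cayley (face P a M) := by
      rw [hFeq, ← smul_cayley_face hPc hmax (fun i => ⟨_, hface i⟩) hm0]
      ext z
      refine and_congr_right fun hz => ?_
      obtain ⟨c, v, hc, hcm, hv, rfl⟩ := (mem_smul_cayley hPc hPne hm0).1 hz
      have h1 : ∑ i, b i * c i = m * B - ∑ i, M i * c i := by
        rw [← hcm, Finset.sum_mul, ← Finset.sum_sub_distrib]
        exact Finset.sum_congr rfl fun i _ => by rw [← hall i]; ring
      rw [hLapp, sumFunctional_apply, h1]
      simp only [Pi.neg_apply, neg_mul, Finset.sum_neg_distrib]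
      constructor <;> intro h <;> linarith
    rw [hFeq'] at hF ⊢
    exact hasLatticeDistance_smul_cayley_face hl hP hdim hm hk hxl hxP hdist hmax hface hpl hF
  · push Not at hall
    obtain ⟨i, hi⟩ := hall
    have hiB : M i + b i < B := lt_of_le_of_ne (hj₀' i) hi
    have hF0 : ∀ z ∈ F, z (Sum.inr i) = 0 := by
      intro z hz
      rw [hFeq] at hz
      obtain ⟨hz, hzB⟩ := hz
      obtain ⟨c, v, hc, hcm, hv, rfl⟩ := (mem_smul_cayley hPc hPne hm0).1 hz
      have h1 := hLle c v hc hcm hv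
      have h2 := Finset.single_le_sum (fun j _ => hterm c hc j) (Finset.mem_univ i)
      have h3 := hterm c hc i
      have h4 : c i * (B - (M i + b i)) = 0 := by linarith
      exact (mul_eq_zero.1 h4).resolve_right (by linarith)
    have hge := le_finrank_of_isFacet_of_forall_eq_zero hl hPc hPne hdim hm0 hF hF0
    have hki : k i = 1 := by
      by_contra hne
      have h1 := hcond i (by have := hk i; omega)
      rw [dim, vectorSpan_sum_set _ hPne] at h1
      omega
    -- The functional -zᵢ is 0 on F and -kᵢ = -1 at the interior point.
    refine hasLatticeDistance_one hlat hF (subset_affineSpan ℝ _ hxP) hxl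
      (-(LinearMap.proj (Sum.inr i) : (Fin n ⊕ Fin l → ℝ) →ₗ[ℝ] ℝ)).toAffineMap ?_ ?_
    · intro z _ hz
      obtain ⟨d, hd⟩ := hz (Sum.inr i)
      exact ⟨-d, by simp [hd]⟩
    · intro y hy
      simp [hF0 y hy, hki]

/-! ### The case of a point, and the proposition -/

/-- A point has no facets, as `dim F + 1 = 0` is impossible, so the distance condition is vacuous.
-/
theorem isReflexive_of_dim_eq_zero {ι : Type*} [Fintype ι] {Q : Set (ι → ℝ)}
    (hQ : IsLatticePolytope Q) (hd : dim Q = 0) : IsReflexive Q := by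
  obtain ⟨z, hz⟩ := Set.Nonempty.intrinsicInterior hQ.convex hQ.nonempty
  obtain ⟨p, hp, hpl, -⟩ := hQ.exists_isMaxOn 0
  have hbot : vectorSpan ℝ Q = ⊥ := Submodule.finrank_eq_zero.1 hd
  have hzp : z - p ∈ vectorSpan ℝ Q := vsub_mem_vectorSpan ℝ (intrinsicInterior_subset hz) hp
  rw [hbot, Submodule.mem_bot, sub_eq_zero] at hzp
  refine ⟨hQ, z, hz, hzp ▸ hpl, fun F hF => ?_⟩
  have := hF.2.2
  omega

end LatticePolytope
end

theorem proposition3p1 (n l r : ℕ) (hl : 1 ≤ l) (P : Fin l → Set (Fin n → ℝ))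
    (hP : ∀ i, LatticePolytope.IsLatticePolytope (P i))
    (hdim : LatticePolytope.dim (∑ i, P i) = n) :
    (LatticePolytope.IsGorenstein (LatticePolytope.cayley P) ∧
        LatticePolytope.codegree (LatticePolytope.cayley P) = r) ↔
      ∃ k : Fin l → ℕ, (∀ i, 1 ≤ k i) ∧ ∑ i, k i = r ∧
        LatticePolytope.IsReflexive (∑ i, (k i : ℝ) • P i) ∧
        ∀ i, 2 ≤ k i → LatticePolytope.dim (∑ j ∈ Finset.univ.erase i, P j) < n := by
  open LatticePolytope in
  have hPne := fun i => (hP i).nonempty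
  have hC := isLatticePolytope_cayley hl hP
  have hd : Module.finrank ℝ
      (⨆ j ∈ Finset.univ, vectorSpan ℝ (P j) : Submodule ℝ (Fin n → ℝ)) = n := by
    rw [← vectorSpan_sum_set _ hPne]
    exact hdim
  have hh : ∀ z ∈ cayley P, height n l z = 1 := fun z hz =>
    height_of_mem_smul_cayley (by simpa using hz)
  have hspan : Submodule.span ℝ (cayley P) = ⊤ := by
    simpa using span_smul_cayley_eq_top hPne hd (one_ne_zero (α := ℝ))
  have hcodeg : ∀ m : ℕ, 1 ≤ m → (2 ≤ n + l ∨ m = 1) → IsReflexive ((m : ℝ) • cayley P) →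
      codegree (cayley P) = m := fun m hm hc href =>
    codegree_eq_of_isReflexive_smul hC hh hspan hm (by simpa using hc) href
  constructor
  · rintro ⟨⟨-, m, hm, href⟩, hr⟩
    -- When the Cayley polytope is a point, the given m need not be the codegree, so it is replaced
    -- by 1.
    obtain ⟨m', hm', hc', href'⟩ : ∃ m' : ℕ, 1 ≤ m' ∧ (2 ≤ n + l ∨ m' = 1) ∧
        IsReflexive ((m' : ℝ) • cayley P) := by
      by_cases hc : 2 ≤ n + l
      · exact ⟨m, hm, Or.inl hc, href⟩
      · refine ⟨1, le_rfl, Or.inr rfl,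
          isReflexive_of_dim_eq_zero (hC.natCast_smul 1) ?_⟩
        have h1 := dim_smul_cayley_add_one hl (m := ((1 : ℕ) : ℝ)) (by simp) hPne
        rw [hd] at h1
        omega
    rw [hcodeg m' hm' hc' href'] at hr
    subst hr
    exact exists_of_isReflexive_smul_cayley hl hP hd hm' hc' href'
  · rintro ⟨k, hk, hkr, href, hcond⟩
    have hlr : l ≤ r := by
      have := Finset.sum_le_sum fun i (_ : i ∈ Finset.univ) => hk i
      simpa [hkr] using this
    have hr1 : 1 ≤ r := hl.trans hlr
    have hm := isReflexive_smul_cayley hl hP hd hk hkr hr1 href hcond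
    refine ⟨⟨hC, r, hr1, hm⟩, hcodeg r hr1 ?_ hm⟩
    -- Here n = 0, l = 1 and r ≥ 2, so some kᵢ ≥ 2, and the second condition would demand a
    -- dimension below 0.
    by_contra! hcon
    obtain ⟨i, hi⟩ : ∃ i, 2 ≤ k i := by
      by_contra! hlt
      have := Finset.sum_le_sum fun i (_ : i ∈ Finset.univ) => Nat.le_of_lt_succ (hlt i)
      have h2 : r ≤ l := by simpa [hkr] using this
      omega
    have := hcond i hi
    omega
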